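/- **Setting.** Formulas are built from literals (propositional variables $P$ and their negations $P^\perp$) by the binary connectives tensor $\otimes$, par $\wp$, with $\&$ and plus $\oplus$, and are identified with their parse trees. A sequent is a finite disjoint union of formulas, i.e. a labelled forest (unordered; comma denotes disjoint union). Cut-free unit-free MALL proofs are built from the rules $$\frac{}{P,P^\perp}\,\mathsf{ax}\quad \frac{\Gamma,A\quad B,\Delta}{\Gamma,A\otimes B,\Delta}\,\otimes\quad \frac{\Gamma,A,B}{\Gamma,A\wp B}\,\wp\quad \frac{\Gamma,A\quad\Gamma,B}{\Gamma,A\& B}\,\&\quad \frac{\Gamma,A}{\Gamma,A\oplus B}\,\oplus_1\quad \frac{\Gamma,B}{\Gamma,A\oplus B}\,\oplus_2\quad \frac{\Gamma\quad\Delta}{\Gamma,\Delta}\,\mathsf{mix}\ \text{(optional)},$$ where each rule tracks the subformula occurrences of its hypotheses to those of its conclusion. The two hypotheses of $\mathsf{mix}$ are unordered. A link on $\Gamma$ is a two-element set of leaves of $\Gamma$, and a linking is a set of links. A proof $\Pi$ of $\Gamma$ translates to the set $\theta_\Pi$ of linkings on $\Gamma$ (its proof net) defined by induction, leaves being tracked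 downwards: an axiom gives $\{\{\{P,P^\perp\}\}\}$; $\wp$, $\oplus_1$, $\oplus_2$ keep $\theta$; $\&$ gives $\theta\cup\theta'$; $\otimes$ and $\mathsf{mix}$ give $\{\lambda\cup\lambda' : \lambda\in\theta,\lambda'\in\theta'\}$. (Equivalently, $\theta_\Pi$ consists of the sets of links given by the axioms of the results of deleting one branch above each $\&$-rule of $\Pi$.) A rule commutation replaces, in any subproof, two adjacent layers of rules by the transposed ones, keeping the subproofs $\Pi_i$ immediately above. Write $\rho_X(\ldots)$ for the rule generating the formula occurrence $X$, where $A=A_1*A_2$ and $B=B_1*'B_2$ are distinct formula occurrences of the conclusion, and $\mathsf m$ for $\mathsf{mix}$. The two hypotheses of a $\otimes$- or $\&$-rule are written below in either order, each being identified by the argument of the generated formula that it contains. The commutations, usable in both directions whenever both sides are proofs of the same sequent, are: * $\rho_B(\rho_A(\Pi_1))\leftrightarrow\rho_A(\rho_B(\Pi_1))$, for each of $A,B$ generated by $\wp$, $\oplus_1$ or $\oplus_2$; * $\rho_A(\Pi_1,\rho_B(\Pi_2))\leftrightarrow\rho_B(\rho_A(\Pi_1,\Pi_2))$, for $A$ generated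 by $\otimes$ and $B$ by $\wp$, $\oplus_1$ or $\oplus_2$; * $\rho_A(\Pi_1,\rho_B(\Pi_2,\Pi_3))\leftrightarrow\rho_B(\rho_A(\Pi_1,\Pi_2),\Pi_3)$, for $A,B$ both generated by $\otimes$; * $\rho_B(\rho_A(\Pi_1),\rho_A(\Pi_2))\leftrightarrow\rho_A(\rho_B(\Pi_1,\Pi_2))$, for $A$ generated by $\wp$, by $\oplus_1$ (both times) or by $\oplus_2$ (both times), and $B$ by $\&$; * $\rho_B(\rho_A(\Pi_1,\Pi_2),\rho_A(\Pi_3,\Pi_4))\leftrightarrow\rho_A(\rho_B(\Pi_1,\Pi_3),\rho_B(\Pi_2,\Pi_4))$, for $A,B$ both generated by $\&$; * $\rho_A(\Pi_1,\rho_B(\Pi_2,\Pi_3))\leftrightarrow\rho_B(\rho_A(\Pi_1,\Pi_2),\rho_A(\Pi_1,\Pi_3))$, for $A$ generated by $\otimes$ and $B$ by $\&$; * if $\mathsf{mix}$ is present: $\mathsf m(\Pi_1,\mathsf m(\Pi_2,\Pi_3))\leftrightarrow\mathsf m(\mathsf m(\Pi_1,\Pi_2),\Pi_3)$; $\ \mathsf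 m(\Pi_1,\rho_B(\Pi_2,\Pi_3))\leftrightarrow\rho_B(\mathsf m(\Pi_1,\Pi_2),\Pi_3)$ for $B$ generated by $\otimes$; $\ \mathsf m(\Pi_1,\rho_B(\Pi_2))\leftrightarrow\rho_B(\mathsf m(\Pi_1,\Pi_2))$ for $B$ generated by $\wp$, $\oplus_1$ or $\oplus_2$; $\ \mathsf m(\Pi_1,\rho_B(\Pi_2,\Pi_3))\leftrightarrow\rho_B(\mathsf m(\Pi_1,\Pi_2),\mathsf m(\Pi_1,\Pi_3))$ for $B$ generated by $\&$. **Theorem.** Both for the calculus with $\mathsf{mix}$ and for the calculus without $\mathsf{mix}$: for every sequent $\Gamma$ and all cut-free MALL proofs $\Pi,\Pi'$ of $\Gamma$, $\theta_\Pi=\theta_{\Pi'}$ if and only if $\Pi$ and $\Pi'$ can be converted into each other by a finite series of rule commutations (of the same calculus). -/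

import Mathlib

namespace MALL

universe u v

/-- Unit-free MALL formulas over the propositional variables `α`: literals `P`, `P⊥`, and the
binary connectives tensor `⊗`, par `⅋`, with `&` (`amp`) and plus `⊕`. -/
inductive Formula (α : Type u) : Type u
  | var (P : α)
  | nvar (P : α)
  | tensor (A B : Formula α)
  | par (A B : Formula α)
  | amp (A B : Formula α)
  | plus (A B : Formula α)

/-- An address of a vertex in a forest of parse trees indexed by `ι`: the tree, and the path
leading from the vertex down to the root of that tree (`false` for a left argument, `true` for a
right argument). -/
abbrev Addr (ι : Type u) : Type u := ι × List Bool

/-- The address of the left (`false`) or right (`true`) argument of the vertex at address `v`. -/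
def Addr.arg {ι : Type u} (v : Addr ι) (b : Bool) : Addr ι := (v.1, b :: v.2)

/-- A formula occurrence: the address of its root vertex, with the formula.  -/
abbrev Occ (ι : Type u) (α : Type v) : Type (max u v) := Addr ι × Formula α

/-- The collections of formula occurrences that label the nodes of a proof.  In a proof of `Γ`,
downward tracking embeds each sequent of the proof into the labelled forest `Γ`; every
subformula occurrence is named by the vertex of `Γ` to which it tracks, so that tracking keeps
addresses fixed. -/
abbrev OccSet (ι : Type u) (α : Type v) : Type (max u v) := Set (Occ ι α)

/-- The sequent that is the disjoint union of the formulas `Γ i`, as a labelled forest. -/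
def sequent {ι : Type u} {α : Type v} (Γ : ι → Formula α) : OccSet ι α :=
  Set.range fun i => ((i, []), Γ i)

/-- `Θ` is the disjoint union `Γ, Δ`. -/
def IsDisjUnion {X : Type u} (Γ Δ Θ : Set X) : Prop := Disjoint Γ Δ ∧ Γ ∪ Δ = Θ

section Rules

variable {ι : Type u} {α : Type v}

/-- `Θ = P, P⊥`. -/
def AxRule (a b : Addr ι) (P : α) (Θ : OccSet ι α) : Prop :=
  IsDisjUnion {(a, .var P)} {(b, .nvar P)} Θ

/-- `Θ₁ = Γ, A` and `Θ₂ = B, Δ` and `Θ = Γ, A ⊗ B, Δ`, with `A ⊗ B` at address `a`. -/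
def TensorRule (a : Addr ι) (A B : Formula α) (Θ₁ Θ₂ Θ : OccSet ι α) : Prop :=
  ∃ Γ Δ ΓΔ : OccSet ι α, IsDisjUnion Γ {(a.arg false, A)} Θ₁ ∧
    IsDisjUnion {(a.arg true, B)} Δ Θ₂ ∧ IsDisjUnion Γ Δ ΓΔ ∧
    IsDisjUnion ΓΔ {(a, .tensor A B)} Θ

/-- `Θ₁ = Γ, A, B` and `Θ = Γ, A ⅋ B`, with `A ⅋ B` at address `a`. -/
def ParRule (a : Addr ι) (A B : Formula α) (Θ₁ Θ : OccSet ι α) : Prop :=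
  ∃ Γ : OccSet ι α, IsDisjUnion Γ {(a.arg false, A), (a.arg true, B)} Θ₁ ∧
    IsDisjUnion Γ {(a, .par A B)} Θ

/-- `Θ₁ = Γ, A` and `Θ₂ = Γ, B` and `Θ = Γ, A & B`, with `A & B` at address `a`. -/
def AmpRule (a : Addr ι) (A B : Formula α) (Θ₁ Θ₂ Θ : OccSet ι α) : Prop :=
  ∃ Γ : OccSet ι α, IsDisjUnion Γ {(a.arg false, A)} Θ₁ ∧
    IsDisjUnion Γ {(a.arg true, B)} Θ₂ ∧ IsDisjUnion Γ {(a, .amp A B)} Θ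

/-- The rules `⊕₁` (`i = false`) and `⊕₂` (`i = true`): `Θ₁ = Γ, A` respectively `Θ₁ = Γ, B`,
and `Θ = Γ, A ⊕ B`, with `A ⊕ B` at address `a`. -/
def PlusRule (i : Bool) (a : Addr ι) (A B : Formula α) (Θ₁ Θ : OccSet ι α) : Prop :=
  ∃ Γ : OccSet ι α, IsDisjUnion Γ {(a.arg i, cond i B A)} Θ₁ ∧
    IsDisjUnion Γ {(a, .plus A B)} Θ

/-- `Θ₁ = Γ` and `Θ₂ = Δ` and `Θ = Γ, Δ`. -/
def MixRule (Θ₁ Θ₂ Θ : OccSet ι α) : Prop := IsDisjUnion Θ₁ Θ₂ Θ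

end Rules

/-- Cut-free MALL proofs of a sequent; `m` says whether the optional mix rule is present.
The hypotheses of the tensor and with rules are written in the order of the arguments to which
they contribute. The hypotheses of mix are unordered in the calculus; that `mix π₁ π₂` and
`mix π₂ π₁` are one proof is accounted for in `Step`. -/
inductive Proof {ι : Type u} {α : Type v} (m : Bool) : OccSet ι α → Type (max u v)
  | ax {a b : Addr ι} {P : α} {Θ : OccSet ι α} (h : AxRule a b P Θ) : Proof m Θ
  | tensor {a : Addr ι} {A B : Formula α} {Θ₁ Θ₂ Θ : OccSet ι α}
      (h : TensorRule a A B Θ₁ Θ₂ Θ) (π₁ : Proof m Θ₁) (π₂ : Proof m Θ₂) : Proof m Θ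
  | par {a : Addr ι} {A B : Formula α} {Θ₁ Θ : OccSet ι α}
      (h : ParRule a A B Θ₁ Θ) (π₁ : Proof m Θ₁) : Proof m Θ
  | amp {a : Addr ι} {A B : Formula α} {Θ₁ Θ₂ Θ : OccSet ι α}
      (h : AmpRule a A B Θ₁ Θ₂ Θ) (π₁ : Proof m Θ₁) (π₂ : Proof m Θ₂) : Proof m Θ
  | plus {i : Bool} {a : Addr ι} {A B : Formula α} {Θ₁ Θ : OccSet ι α}
      (h : PlusRule i a A B Θ₁ Θ) (π₁ : Proof m Θ₁) : Proof m Θ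
  | mix {Θ₁ Θ₂ Θ : OccSet ι α} (hm : m = true)
      (h : MixRule Θ₁ Θ₂ Θ) (π₁ : Proof m Θ₁) (π₂ : Proof m Θ₂) : Proof m Θ

/-- A link: an unordered pair of leaves (literal occurrences). -/
abbrev Link (ι : Type u) (α : Type v) : Type (max u v) := Sym2 (Occ ι α)

/-- A linking: a set of links. -/
abbrev Linking (ι : Type u) (α : Type v) : Type (max u v) := Set (Link ι α)

/-- The set of linkings `θ_π` to which the proof `π` translates. -/
def Proof.net {ι : Type u} {α : Type v} {m : Bool} :
    {Θ : OccSet ι α} → Proof m Θ → Set (Linking ι α)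
  | _, @Proof.ax _ _ _ a b P _ _ => {{s((a, .var P), (b, .nvar P))}}
  | _, .tensor _ π₁ π₂ => {l | ∃ l₁ ∈ π₁.net, ∃ l₂ ∈ π₂.net, l = l₁ ∪ l₂}
  | _, .par _ π₁ => π₁.net
  | _, .amp _ π₁ π₂ => π₁.net ∪ π₂.net
  | _, .plus _ π₁ => π₁.net
  | _, .mix _ _ π₁ π₂ => {l | ∃ l₁ ∈ π₁.net, ∃ l₂ ∈ π₂.net, l = l₁ ∪ l₂}

/-- The rule commutations, applied at the root.  `A` (at address `a`) and `B` (at address `b`)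
are the formulas `A₁ * A₂` and `B₁ * B₂` generated by the two rules.  That both sides are proofs
with the given subproofs forces the arguments of `A` and `B` to lie in the hypotheses where they
are needed, and forbids that one of `A`, `B` is an argument of the other. -/
inductive Commutes {ι : Type u} {α : Type v} {m : Bool} :
    {Θ : OccSet ι α} → Proof m Θ → Proof m Θ → Prop
  -- homogeneous commutations
  | par_par {a b : Addr ι} {A₁ A₂ B₁ B₂ : Formula α} {Θ₁ Φ Ψ Θ : OccSet ι α}
      (π₁ : Proof m Θ₁)
      (h₁ : ParRule a A₁ A₂ Θ₁ Φ) (h : ParRule b B₁ B₂ Φ Θ)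
      (k₁ : ParRule b B₁ B₂ Θ₁ Ψ) (k : ParRule a A₁ A₂ Ψ Θ) :
      Commutes (.par h (.par h₁ π₁)) (.par k (.par k₁ π₁))
  | plus_plus {i j : Bool} {a b : Addr ι} {A₁ A₂ B₁ B₂ : Formula α} {Θ₁ Φ Ψ Θ : OccSet ι α}
      (π₁ : Proof m Θ₁)
      (h₁ : PlusRule i a A₁ A₂ Θ₁ Φ) (h : PlusRule j b B₁ B₂ Φ Θ)
      (k₁ : PlusRule j b B₁ B₂ Θ₁ Ψ) (k : PlusRule i a A₁ A₂ Ψ Θ) :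
      Commutes (.plus h (.plus h₁ π₁)) (.plus k (.plus k₁ π₁))
  /- `A₂` and `B₁` occur in the same hypothesis -/
  | tensor_tensor {a b : Addr ι} {A₁ A₂ B₁ B₂ : Formula α} {Θ₁ Θ₂ Θ₃ Φ Ψ Θ : OccSet ι α}
      (π₁ : Proof m Θ₁) (π₂ : Proof m Θ₂) (π₃ : Proof m Θ₃)
      (h₁ : TensorRule b B₁ B₂ Θ₂ Θ₃ Φ) (h : TensorRule a A₁ A₂ Θ₁ Φ Θ)
      (k₁ : TensorRule a A₁ A₂ Θ₁ Θ₂ Ψ) (k : TensorRule b B₁ B₂ Ψ Θ₃ Θ) :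
      Commutes (.tensor h π₁ (.tensor h₁ π₂ π₃)) (.tensor k (.tensor k₁ π₁ π₂) π₃)
  /- `A₂` and `B₂` occur in the same hypothesis -/
  | tensor_tensor_right {a b : Addr ι} {A₁ A₂ B₁ B₂ : Formula α}
      {Θ₁ Θ₂ Θ₃ Φ Ψ Θ : OccSet ι α}
      (π₁ : Proof m Θ₁) (π₂ : Proof m Θ₂) (π₃ : Proof m Θ₃)
      (h₁ : TensorRule b B₁ B₂ Θ₃ Θ₂ Φ) (h : TensorRule a A₁ A₂ Θ₁ Φ Θ)
      (k₁ : TensorRule a A₁ A₂ Θ₁ Θ₂ Ψ) (k : TensorRule b B₁ B₂ Θ₃ Ψ Θ) :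
      Commutes (.tensor h π₁ (.tensor h₁ π₃ π₂)) (.tensor k π₃ (.tensor k₁ π₁ π₂))
  /- `A₁` and `B₁` occur in the same hypothesis -/
  | tensor_tensor_left {a b : Addr ι} {A₁ A₂ B₁ B₂ : Formula α}
      {Θ₁ Θ₂ Θ₃ Φ Ψ Θ : OccSet ι α}
      (π₁ : Proof m Θ₁) (π₂ : Proof m Θ₂) (π₃ : Proof m Θ₃)
      (h₁ : TensorRule b B₁ B₂ Θ₂ Θ₃ Φ) (h : TensorRule a A₁ A₂ Φ Θ₁ Θ)
      (k₁ : TensorRule a A₁ A₂ Θ₂ Θ₁ Ψ) (k : TensorRule b B₁ B₂ Ψ Θ₃ Θ) :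
      Commutes (.tensor h (.tensor h₁ π₂ π₃) π₁) (.tensor k (.tensor k₁ π₂ π₁) π₃)
  | amp_amp {a b : Addr ι} {A₁ A₂ B₁ B₂ : Formula α}
      {Θ₁ Θ₂ Θ₃ Θ₄ Φ₁ Φ₂ Ψ₁ Ψ₂ Θ : OccSet ι α}
      (π₁ : Proof m Θ₁) (π₂ : Proof m Θ₂) (π₃ : Proof m Θ₃) (π₄ : Proof m Θ₄)
      (h₁ : AmpRule a A₁ A₂ Θ₁ Θ₂ Φ₁) (h₂ : AmpRule a A₁ A₂ Θ₃ Θ₄ Φ₂)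
      (h : AmpRule b B₁ B₂ Φ₁ Φ₂ Θ)
      (k₁ : AmpRule b B₁ B₂ Θ₁ Θ₃ Ψ₁) (k₂ : AmpRule b B₁ B₂ Θ₂ Θ₄ Ψ₂)
      (k : AmpRule a A₁ A₂ Ψ₁ Ψ₂ Θ) :
      Commutes (.amp h (.amp h₁ π₁ π₂) (.amp h₂ π₃ π₄))
        (.amp k (.amp k₁ π₁ π₃) (.amp k₂ π₂ π₄))
  -- heterogeneous commutations
  | plus_par {i : Bool} {a b : Addr ι} {A₁ A₂ B₁ B₂ : Formula α} {Θ₁ Φ Ψ Θ : OccSet ι α}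
      (π₁ : Proof m Θ₁)
      (h₁ : PlusRule i a A₁ A₂ Θ₁ Φ) (h : ParRule b B₁ B₂ Φ Θ)
      (k₁ : ParRule b B₁ B₂ Θ₁ Ψ) (k : PlusRule i a A₁ A₂ Ψ Θ) :
      Commutes (.par h (.plus h₁ π₁)) (.plus k (.par k₁ π₁))
  | plus_amp {i : Bool} {a b : Addr ι} {A₁ A₂ B₁ B₂ : Formula α}
      {Θ₁ Θ₂ Φ₁ Φ₂ Ψ Θ : OccSet ι α}
      (π₁ : Proof m Θ₁) (π₂ : Proof m Θ₂)
      (h₁ : PlusRule i a A₁ A₂ Θ₁ Φ₁) (h₂ : PlusRule i a A₁ A₂ Θ₂ Φ₂)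
      (h : AmpRule b B₁ B₂ Φ₁ Φ₂ Θ)
      (k₁ : AmpRule b B₁ B₂ Θ₁ Θ₂ Ψ) (k : PlusRule i a A₁ A₂ Ψ Θ) :
      Commutes (.amp h (.plus h₁ π₁) (.plus h₂ π₂)) (.plus k (.amp k₁ π₁ π₂))
  | par_amp {a b : Addr ι} {A₁ A₂ B₁ B₂ : Formula α} {Θ₁ Θ₂ Φ₁ Φ₂ Ψ Θ : OccSet ι α}
      (π₁ : Proof m Θ₁) (π₂ : Proof m Θ₂)
      (h₁ : ParRule a A₁ A₂ Θ₁ Φ₁) (h₂ : ParRule a A₁ A₂ Θ₂ Φ₂)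
      (h : AmpRule b B₁ B₂ Φ₁ Φ₂ Θ)
      (k₁ : AmpRule b B₁ B₂ Θ₁ Θ₂ Ψ) (k : ParRule a A₁ A₂ Ψ Θ) :
      Commutes (.amp h (.par h₁ π₁) (.par h₂ π₂)) (.par k (.amp k₁ π₁ π₂))
  | plus_tensor {i : Bool} {a b : Addr ι} {A₁ A₂ B₁ B₂ : Formula α}
      {Θ₁ Θ₂ Φ Ψ Θ : OccSet ι α}
      (π₁ : Proof m Θ₁) (π₂ : Proof m Θ₂)
      (h₁ : PlusRule i b B₁ B₂ Θ₂ Φ) (h : TensorRule a A₁ A₂ Θ₁ Φ Θ)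
      (k₁ : TensorRule a A₁ A₂ Θ₁ Θ₂ Ψ) (k : PlusRule i b B₁ B₂ Ψ Θ) :
      Commutes (.tensor h π₁ (.plus h₁ π₂)) (.plus k (.tensor k₁ π₁ π₂))
  | plus_tensor_left {i : Bool} {a b : Addr ι} {A₁ A₂ B₁ B₂ : Formula α}
      {Θ₁ Θ₂ Φ Ψ Θ : OccSet ι α}
      (π₁ : Proof m Θ₁) (π₂ : Proof m Θ₂)
      (h₁ : PlusRule i b B₁ B₂ Θ₂ Φ) (h : TensorRule a A₁ A₂ Φ Θ₁ Θ)
      (k₁ : TensorRule a A₁ A₂ Θ₂ Θ₁ Ψ) (k : PlusRule i b B₁ B₂ Ψ Θ) :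
      Commutes (.tensor h (.plus h₁ π₂) π₁) (.plus k (.tensor k₁ π₂ π₁))
  | par_tensor {a b : Addr ι} {A₁ A₂ B₁ B₂ : Formula α} {Θ₁ Θ₂ Φ Ψ Θ : OccSet ι α}
      (π₁ : Proof m Θ₁) (π₂ : Proof m Θ₂)
      (h₁ : ParRule b B₁ B₂ Θ₂ Φ) (h : TensorRule a A₁ A₂ Θ₁ Φ Θ)
      (k₁ : TensorRule a A₁ A₂ Θ₁ Θ₂ Ψ) (k : ParRule b B₁ B₂ Ψ Θ) :
      Commutes (.tensor h π₁ (.par h₁ π₂)) (.par k (.tensor k₁ π₁ π₂))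
  | par_tensor_left {a b : Addr ι} {A₁ A₂ B₁ B₂ : Formula α} {Θ₁ Θ₂ Φ Ψ Θ : OccSet ι α}
      (π₁ : Proof m Θ₁) (π₂ : Proof m Θ₂)
      (h₁ : ParRule b B₁ B₂ Θ₂ Φ) (h : TensorRule a A₁ A₂ Φ Θ₁ Θ)
      (k₁ : TensorRule a A₁ A₂ Θ₂ Θ₁ Ψ) (k : ParRule b B₁ B₂ Ψ Θ) :
      Commutes (.tensor h (.par h₁ π₂) π₁) (.par k (.tensor k₁ π₂ π₁))
  | amp_tensor {a b : Addr ι} {A₁ A₂ B₁ B₂ : Formula α} {Θ₁ Θ₂ Θ₃ Φ Ψ₁ Ψ₂ Θ : OccSet ι α}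
      (π₁ : Proof m Θ₁) (π₂ : Proof m Θ₂) (π₃ : Proof m Θ₃)
      (h₁ : AmpRule b B₁ B₂ Θ₂ Θ₃ Φ) (h : TensorRule a A₁ A₂ Θ₁ Φ Θ)
      (k₁ : TensorRule a A₁ A₂ Θ₁ Θ₂ Ψ₁) (k₂ : TensorRule a A₁ A₂ Θ₁ Θ₃ Ψ₂)
      (k : AmpRule b B₁ B₂ Ψ₁ Ψ₂ Θ) :
      Commutes (.tensor h π₁ (.amp h₁ π₂ π₃))
        (.amp k (.tensor k₁ π₁ π₂) (.tensor k₂ π₁ π₃))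
  | amp_tensor_left {a b : Addr ι} {A₁ A₂ B₁ B₂ : Formula α}
      {Θ₁ Θ₂ Θ₃ Φ Ψ₁ Ψ₂ Θ : OccSet ι α}
      (π₁ : Proof m Θ₁) (π₂ : Proof m Θ₂) (π₃ : Proof m Θ₃)
      (h₁ : AmpRule b B₁ B₂ Θ₂ Θ₃ Φ) (h : TensorRule a A₁ A₂ Φ Θ₁ Θ)
      (k₁ : TensorRule a A₁ A₂ Θ₂ Θ₁ Ψ₁) (k₂ : TensorRule a A₁ A₂ Θ₃ Θ₁ Ψ₂)
      (k : AmpRule b B₁ B₂ Ψ₁ Ψ₂ Θ) :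
      Commutes (.tensor h (.amp h₁ π₂ π₃) π₁)
        (.amp k (.tensor k₁ π₂ π₁) (.tensor k₂ π₃ π₁))
  -- mix commutations
  | mix_mix {Θ₁ Θ₂ Θ₃ Φ Ψ Θ : OccSet ι α} (hm : m = true)
      (π₁ : Proof m Θ₁) (π₂ : Proof m Θ₂) (π₃ : Proof m Θ₃)
      (h₁ : MixRule Θ₂ Θ₃ Φ) (h : MixRule Θ₁ Φ Θ)
      (k₁ : MixRule Θ₁ Θ₂ Ψ) (k : MixRule Ψ Θ₃ Θ) :
      Commutes (.mix hm h π₁ (.mix hm h₁ π₂ π₃)) (.mix hm k (.mix hm k₁ π₁ π₂) π₃)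
  | tensor_mix {b : Addr ι} {B₁ B₂ : Formula α} {Θ₁ Θ₂ Θ₃ Φ Ψ Θ : OccSet ι α}
      (hm : m = true) (π₁ : Proof m Θ₁) (π₂ : Proof m Θ₂) (π₃ : Proof m Θ₃)
      (h₁ : TensorRule b B₁ B₂ Θ₂ Θ₃ Φ) (h : MixRule Θ₁ Φ Θ)
      (k₁ : MixRule Θ₁ Θ₂ Ψ) (k : TensorRule b B₁ B₂ Ψ Θ₃ Θ) :
      Commutes (.mix hm h π₁ (.tensor h₁ π₂ π₃)) (.tensor k (.mix hm k₁ π₁ π₂) π₃)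
  | tensor_mix_right {b : Addr ι} {B₁ B₂ : Formula α} {Θ₁ Θ₂ Θ₃ Φ Ψ Θ : OccSet ι α}
      (hm : m = true) (π₁ : Proof m Θ₁) (π₂ : Proof m Θ₂) (π₃ : Proof m Θ₃)
      (h₁ : TensorRule b B₁ B₂ Θ₂ Θ₃ Φ) (h : MixRule Θ₁ Φ Θ)
      (k₁ : MixRule Θ₁ Θ₃ Ψ) (k : TensorRule b B₁ B₂ Θ₂ Ψ Θ) :
      Commutes (.mix hm h π₁ (.tensor h₁ π₂ π₃)) (.tensor k π₂ (.mix hm k₁ π₁ π₃))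
  | plus_mix {i : Bool} {b : Addr ι} {B₁ B₂ : Formula α} {Θ₁ Θ₂ Φ Ψ Θ : OccSet ι α}
      (hm : m = true) (π₁ : Proof m Θ₁) (π₂ : Proof m Θ₂)
      (h₁ : PlusRule i b B₁ B₂ Θ₂ Φ) (h : MixRule Θ₁ Φ Θ)
      (k₁ : MixRule Θ₁ Θ₂ Ψ) (k : PlusRule i b B₁ B₂ Ψ Θ) :
      Commutes (.mix hm h π₁ (.plus h₁ π₂)) (.plus k (.mix hm k₁ π₁ π₂))
  | par_mix {b : Addr ι} {B₁ B₂ : Formula α} {Θ₁ Θ₂ Φ Ψ Θ : OccSet ι α}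
      (hm : m = true) (π₁ : Proof m Θ₁) (π₂ : Proof m Θ₂)
      (h₁ : ParRule b B₁ B₂ Θ₂ Φ) (h : MixRule Θ₁ Φ Θ)
      (k₁ : MixRule Θ₁ Θ₂ Ψ) (k : ParRule b B₁ B₂ Ψ Θ) :
      Commutes (.mix hm h π₁ (.par h₁ π₂)) (.par k (.mix hm k₁ π₁ π₂))
  | amp_mix {b : Addr ι} {B₁ B₂ : Formula α} {Θ₁ Θ₂ Θ₃ Φ Ψ₁ Ψ₂ Θ : OccSet ι α}
      (hm : m = true) (π₁ : Proof m Θ₁) (π₂ : Proof m Θ₂) (π₃ : Proof m Θ₃)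
      (h₁ : AmpRule b B₁ B₂ Θ₂ Θ₃ Φ) (h : MixRule Θ₁ Φ Θ)
      (k₁ : MixRule Θ₁ Θ₂ Ψ₁) (k₂ : MixRule Θ₁ Θ₃ Ψ₂) (k : AmpRule b B₁ B₂ Ψ₁ Ψ₂ Θ) :
      Commutes (.mix hm h π₁ (.amp h₁ π₂ π₃))
        (.amp k (.mix hm k₁ π₁ π₂) (.mix hm k₂ π₁ π₃))

/-- One rule commutation, applied to any subproof. The clause `mix_swap` only expresses that the
two hypotheses of mix are unordered. -/
inductive Step {ι : Type u} {α : Type v} {m : Bool} :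
    {Θ : OccSet ι α} → Proof m Θ → Proof m Θ → Prop
  | commute {Θ : OccSet ι α} {π π' : Proof m Θ} (h : Commutes π π') : Step π π'
  | mix_swap {Θ₁ Θ₂ Θ : OccSet ι α} (hm : m = true) (π₁ : Proof m Θ₁) (π₂ : Proof m Θ₂)
      (h : MixRule Θ₁ Θ₂ Θ) (k : MixRule Θ₂ Θ₁ Θ) :
      Step (.mix hm h π₁ π₂) (.mix hm k π₂ π₁)
  | tensor_left {a : Addr ι} {A B : Formula α} {Θ₁ Θ₂ Θ : OccSet ι α}
      (h : TensorRule a A B Θ₁ Θ₂ Θ) {π₁ π₁' : Proof m Θ₁} (π₂ : Proof m Θ₂) :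
      Step π₁ π₁' → Step (.tensor h π₁ π₂) (.tensor h π₁' π₂)
  | tensor_right {a : Addr ι} {A B : Formula α} {Θ₁ Θ₂ Θ : OccSet ι α}
      (h : TensorRule a A B Θ₁ Θ₂ Θ) (π₁ : Proof m Θ₁) {π₂ π₂' : Proof m Θ₂} :
      Step π₂ π₂' → Step (.tensor h π₁ π₂) (.tensor h π₁ π₂')
  | par {a : Addr ι} {A B : Formula α} {Θ₁ Θ : OccSet ι α}
      (h : ParRule a A B Θ₁ Θ) {π₁ π₁' : Proof m Θ₁} :
      Step π₁ π₁' → Step (.par h π₁) (.par h π₁')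
  | amp_left {a : Addr ι} {A B : Formula α} {Θ₁ Θ₂ Θ : OccSet ι α}
      (h : AmpRule a A B Θ₁ Θ₂ Θ) {π₁ π₁' : Proof m Θ₁} (π₂ : Proof m Θ₂) :
      Step π₁ π₁' → Step (.amp h π₁ π₂) (.amp h π₁' π₂)
  | amp_right {a : Addr ι} {A B : Formula α} {Θ₁ Θ₂ Θ : OccSet ι α}
      (h : AmpRule a A B Θ₁ Θ₂ Θ) (π₁ : Proof m Θ₁) {π₂ π₂' : Proof m Θ₂} :
      Step π₂ π₂' → Step (.amp h π₁ π₂) (.amp h π₁ π₂')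
  | plus {i : Bool} {a : Addr ι} {A B : Formula α} {Θ₁ Θ : OccSet ι α}
      (h : PlusRule i a A B Θ₁ Θ) {π₁ π₁' : Proof m Θ₁} :
      Step π₁ π₁' → Step (.plus h π₁) (.plus h π₁')
  | mix_left {Θ₁ Θ₂ Θ : OccSet ι α} (hm : m = true)
      (h : MixRule Θ₁ Θ₂ Θ) {π₁ π₁' : Proof m Θ₁} (π₂ : Proof m Θ₂) :
      Step π₁ π₁' → Step (.mix hm h π₁ π₂) (.mix hm h π₁' π₂)
  | mix_right {Θ₁ Θ₂ Θ : OccSet ι α} (hm : m = true)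
      (h : MixRule Θ₁ Θ₂ Θ) (π₁ : Proof m Θ₁) {π₂ π₂' : Proof m Θ₂} :
      Step π₂ π₂' → Step (.mix hm h π₁ π₂) (.mix hm h π₁ π₂')

/-- `π` and `π'` can be converted into each other by a finite series of rule commutations, each
used in either direction. -/
def Convertible {ι : Type u} {α : Type v} {m : Bool} {Θ : OccSet ι α} (π π' : Proof m Θ) :
    Prop :=
  Relation.EqvGen Step π π'

end MALL

namespace MALL

universe u v
variable {ι : Type u} {α : Type v} {m : Bool}

/-! ### Addresses and regions -/

/-- `w` lies in the subtree rooted at `a`. -/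
def Addr.Below (a w : Addr ι) : Prop := a.1 = w.1 ∧ a.2 <:+ w.2

theorem Addr.Below.refl (a : Addr ι) : a.Below a := ⟨rfl, List.suffix_refl _⟩

theorem Addr.Below.trans {a b c : Addr ι} (h : a.Below b) (h' : b.Below c) : a.Below c :=
  ⟨h.1.trans h'.1, h.2.trans h'.2⟩

theorem Addr.below_arg (a : Addr ι) (i : Bool) : a.Below (a.arg i) :=
  ⟨rfl, List.suffix_cons _ _⟩

theorem Addr.not_arg_below (a : Addr ι) (i : Bool) : ¬ (a.arg i).Below a := by
  rintro ⟨-, h⟩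
  have := h.length_le
  simp [Addr.arg] at this

theorem Addr.arg_below_inj {a w : Addr ι} {i j : Bool} (h : (a.arg i).Below w)
    (h' : (a.arg j).Below w) : i = j := by
  have := List.suffix_of_suffix_length_le h.2 h'.2 (by simp [Addr.arg])
  have := this.eq_of_length (by simp [Addr.arg])
  simpa [Addr.arg] using this

/-- The addresses that lie in the subtree of some member of `S`. -/
def region (S : OccSet ι α) : Set (Addr ι) := {w | ∃ o ∈ S, o.1.Below w}

theorem region_mono {S T : OccSet ι α} (h : S ⊆ T) : region S ⊆ region T :=
  fun _ ⟨o, ho, hw⟩ => ⟨o, h ho, hw⟩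

theorem region_union (S T : OccSet ι α) : region (S ∪ T) = region S ∪ region T := by
  ext w; simp only [region, Set.mem_union, Set.mem_ofPred_eq, or_and_right, exists_or]

/-- A finite collection of occurrences with pairwise disjoint subtrees. -/
def WellFormed (Θ : OccSet ι α) : Prop :=
  Θ.Finite ∧ ∀ o ∈ Θ, ∀ o' ∈ Θ, ∀ w : Addr ι, o.1.Below w → o'.1.Below w → o = o'

theorem WellFormed.mono {Θ Φ : OccSet ι α} (h : WellFormed Θ) (hs : Φ ⊆ Θ) : WellFormed Φ :=
  ⟨h.1.subset hs, fun o ho o' ho' => h.2 o (hs ho) o' (hs ho')⟩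

theorem WellFormed.disjoint_region {Θ S T : OccSet ι α} (h : WellFormed Θ) (hS : S ⊆ Θ)
    (hT : T ⊆ Θ) (hST : Disjoint S T) : Disjoint (region S) (region T) := by
  rw [Set.disjoint_left] at hST ⊢
  rintro w ⟨o, ho, hw⟩ ⟨o', ho', hw'⟩
  exact hST ho (h.2 o (hS ho) o' (hT ho') w hw hw' ▸ ho')

theorem wellFormed_sequent [Finite ι] (Γ : ι → Formula α) : WellFormed (sequent Γ) := by
  refine ⟨Set.finite_range _, ?_⟩
  rintro _ ⟨i, rfl⟩ _ ⟨j, rfl⟩ w ⟨h, -⟩ ⟨h', -⟩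
  simp only at h h'
  rw [h, h']

/-- `L` is a collection of vertices strictly inside the subtrees of `P`. -/
def Refines (L P : OccSet ι α) : Prop :=
  WellFormed L ∧ region L ⊆ region P ∧ ∀ x ∈ L, ∀ p ∈ P, ¬ x.1.Below p.1

theorem Refines.mono {L L' P : OccSet ι α} (h : Refines L P) (hs : L' ⊆ L) : Refines L' P :=
  ⟨h.1.mono hs, (region_mono hs).trans h.2.1, fun x hx => h.2.2 x (hs hx)⟩

theorem Refines.notMem {L P Θ : OccSet ι α} (h : Refines L P) (hΘ : WellFormed Θ) (hP : P ⊆ Θ)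
    {x : Occ ι α} (hx : x ∈ L) : x ∉ Θ := by
  intro hxΘ
  obtain ⟨p, hp, hpx⟩ := h.2.1 ⟨x, hx, .refl _⟩
  obtain rfl := hΘ.2 p (hP hp) x hxΘ _ hpx (.refl _)
  exact h.2.2 _ hx _ hp (.refl _)

theorem Refines.wellFormed {L P Θ : OccSet ι α} (h : Refines L P) (hΘ : WellFormed Θ)
    (hP : P ⊆ Θ) : WellFormed (Θ \ P ∪ L) := by
  refine ⟨(hΘ.1.subset Set.sdiff_subset).union h.1.1, ?_⟩
  have key : ∀ o ∈ Θ \ P, ∀ o' ∈ L, ∀ w : Addr ι, o.1.Below w → o'.1.Below w → False := by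
    intro o ho o' ho' w hw hw'
    obtain ⟨p, hp, hpw⟩ := h.2.1 ⟨o', ho', hw'⟩
    exact ho.2 (hΘ.2 p (hP hp) o ho.1 w hpw hw ▸ hp)
  rintro o (ho | ho) o' (ho' | ho') w hw hw'
  · exact hΘ.2 o ho.1 o' ho'.1 w hw hw'
  · exact (key o ho o' ho' w hw hw').elim
  · exact (key o' ho' o ho w hw' hw).elim
  · exact h.1.2 o ho o' ho' w hw hw'

theorem refines_pair (a : Addr ι) (A B F : Formula α) :
    Refines ({(a.arg false, A)} ∪ {(a.arg true, B)}) {(a, F)} := by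
  refine ⟨⟨(Set.finite_singleton _).union (Set.finite_singleton _), ?_⟩, ?_, ?_⟩
  · rintro _ (rfl | rfl) _ (rfl | rfl) w hw hw'
    · rfl
    · exact absurd (Addr.arg_below_inj hw hw') (by simp)
    · exact absurd (Addr.arg_below_inj hw hw') (by simp)
    · rfl
  · rintro w ⟨_, (rfl | rfl), hw⟩
    · exact ⟨_, rfl, (Addr.below_arg a _).trans hw⟩
    · exact ⟨_, rfl, (Addr.below_arg a _).trans hw⟩
  · rintro _ (rfl | rfl) _ rfl
    · exact Addr.not_arg_below a _
    · exact Addr.not_arg_below a _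

theorem refines_empty (P : OccSet ι α) : Refines ∅ P := by
  refine ⟨⟨Set.finite_empty, ?_⟩, ?_, ?_⟩ <;> simp [region]

/-! ### Weights -/

/-- The number of vertices of the parse tree. -/
def Formula.size : Formula α → ℕ
  | .var _ => 1
  | .nvar _ => 1
  | .tensor A B => A.size + B.size + 1
  | .par A B => A.size + B.size + 1
  | .amp A B => A.size + B.size + 1
  | .plus A B => A.size + B.size + 1

theorem Formula.size_pos (A : Formula α) : 0 < A.size := by
  cases A <;> simp [Formula.size]

/-- The number of vertices of a finite sequent. -/
noncomputable def weight (Θ : OccSet ι α) : ℕ := ∑ᶠ o ∈ Θ, o.2.size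

theorem weight_empty : weight (∅ : OccSet ι α) = 0 := finsum_mem_empty

theorem weight_singleton (o : Occ ι α) : weight {o} = o.2.size := finsum_mem_singleton

theorem weight_union {S T : OccSet ι α} (hS : S.Finite) (hT : T.Finite) (h : Disjoint S T) :
    weight (S ∪ T) = weight S + weight T := finsum_mem_union h hS hT

theorem weight_pos {S : OccSet ι α} (hS : S.Finite) (h : S.Nonempty) : 0 < weight S := by
  obtain ⟨o, ho⟩ := h
  have : weight S = weight {o} + weight (S \ {o}) := by
    rw [← weight_union (Set.finite_singleton o) (hS.subset Set.sdiff_subset)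
      Set.disjoint_sdiff_right, Set.union_sdiff_cancel (by simpa using ho)]
  rw [this, weight_singleton]
  have := o.2.size_pos
  omega

/-! ### Kinds of rules -/

theorem isDisjUnion_iff {X : Type u} {Γ Δ Θ : Set X} :
    IsDisjUnion Γ Δ Θ ↔ ∀ x, ¬ (x ∈ Γ ∧ x ∈ Δ) ∧ (x ∈ Θ ↔ x ∈ Γ ∨ x ∈ Δ) := by
  unfold IsDisjUnion
  rw [forall_and, Set.disjoint_left]
  refine and_congr (by simp) ?_
  rw [eq_comm, Set.ext_iff]
  rfl

/-- The rules with two hypotheses whose contexts are joined: tensor, tensor with its hypotheses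
listed in the opposite order, and mix. -/
inductive JKind (ι : Type u) (α : Type v) : Type (max u v)
  | tensor (a : Addr ι) (A B : Formula α)
  | tensorFlip (a : Addr ι) (A B : Formula α)
  | mix

namespace JKind

/-- The kind with the two hypotheses exchanged. -/
def flip : JKind ι α → JKind ι α
  | tensor a A B => tensorFlip a A B
  | tensorFlip a A B => tensor a A B
  | mix => mix

/-- The generated formula, if any. -/
def prin : JKind ι α → OccSet ι α
  | tensor a A B => {(a, .tensor A B)}
  | tensorFlip a A B => {(a, .tensor A B)}
  | mix => ∅

/-- The argument contained in the first hypothesis. -/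
def left : JKind ι α → OccSet ι α
  | tensor a A _ => {(a.arg false, A)}
  | tensorFlip a _ B => {(a.arg true, B)}
  | mix => ∅

/-- The argument contained in the second hypothesis. -/
def right : JKind ι α → OccSet ι α
  | tensor a _ B => {(a.arg true, B)}
  | tensorFlip a A _ => {(a.arg false, A)}
  | mix => ∅

/-- The rule of a given kind. -/
def Rule : JKind ι α → OccSet ι α → OccSet ι α → OccSet ι α → Prop
  | tensor a A B, Θ₁, Θ₂, Θ => TensorRule a A B Θ₁ Θ₂ Θ
  | tensorFlip a A B, Θ₁, Θ₂, Θ => TensorRule a A B Θ₂ Θ₁ Θ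
  | mix, Θ₁, Θ₂, Θ => MixRule Θ₁ Θ₂ Θ

/-- The rule belongs to the calculus. -/
def Ok (m : Bool) : JKind ι α → Prop
  | mix => m = true
  | _ => True

theorem Ok.flip {k : JKind ι α} (h : k.Ok m) : k.flip.Ok m := by
  cases k <;> exact h

theorem flip_flip (k : JKind ι α) : k.flip.flip = k := by cases k <;> rfl
theorem prin_flip (k : JKind ι α) : k.flip.prin = k.prin := by cases k <;> rfl

theorem Rule.flip {k : JKind ι α} {Θ₁ Θ₂ Θ : OccSet ι α} (h : k.Rule Θ₁ Θ₂ Θ) :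
    k.flip.Rule Θ₂ Θ₁ Θ := by
  cases k with
  | mix => exact ⟨h.1.symm, by rw [Set.union_comm]; exact h.2⟩
  | _ => exact h

theorem refines (k : JKind ι α) : Refines (k.left ∪ k.right) k.prin := by
  cases k with
  | tensor a A B => exact refines_pair ..
  | tensorFlip a A B => rw [Set.union_comm]; exact refines_pair ..
  | mix => simpa [left, right] using refines_empty _

theorem disjoint_left_right (k : JKind ι α) (x : Occ ι α) : ¬ (x ∈ k.left ∧ x ∈ k.right) := by
  cases k <;> simp +contextual [left, right, Addr.arg]

/-- Membership form of `Rule`. -/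
def Split (k : JKind ι α) (Γ Δ Θ₁ Θ₂ Θ : OccSet ι α) : Prop :=
  ∀ x, (x ∈ Θ₁ ↔ x ∈ Γ ∨ x ∈ k.left) ∧ (x ∈ Θ₂ ↔ x ∈ Δ ∨ x ∈ k.right) ∧
    (x ∈ Θ ↔ x ∈ Γ ∨ x ∈ Δ ∨ x ∈ k.prin) ∧ ¬ (x ∈ Γ ∧ x ∈ Δ) ∧ ¬ (x ∈ Γ ∧ x ∈ k.left) ∧
    ¬ (x ∈ Δ ∧ x ∈ k.right) ∧ ¬ (x ∈ Γ ∧ x ∈ k.prin) ∧ ¬ (x ∈ Δ ∧ x ∈ k.prin)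

theorem tensorRule_iff {a : Addr ι} {A B : Formula α} {Θ₁ Θ₂ Θ : OccSet ι α} :
    TensorRule a A B Θ₁ Θ₂ Θ ↔ ∃ Γ Δ, (tensor a A B).Split Γ Δ Θ₁ Θ₂ Θ := by
  simp only [TensorRule, isDisjUnion_iff, ← forall_and, Split, left, right, prin]
  constructor
  · rintro ⟨Γ, Δ, ΓΔ, h⟩
    refine ⟨Γ, Δ, fun x => ?_⟩
    have := h x
    grind
  · rintro ⟨Γ, Δ, h⟩
    refine ⟨Γ, Δ, Γ ∪ Δ, fun x => ?_⟩
    have := h x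
    grind

theorem rule_iff {k : JKind ι α} {Θ₁ Θ₂ Θ : OccSet ι α} :
    k.Rule Θ₁ Θ₂ Θ ↔ ∃ Γ Δ, k.Split Γ Δ Θ₁ Θ₂ Θ := by
  cases k with
  | tensor a A B => exact tensorRule_iff
  | tensorFlip a A B =>
    refine tensorRule_iff.trans ?_
    rw [exists_comm]
    refine exists_congr fun Γ => exists_congr fun Δ => forall_congr' fun x => ?_
    simp only [left, right, prin]
    grind
  | mix =>
    simp only [Rule, MixRule, isDisjUnion_iff, Split, left, right, prin]
    constructor
    · intro h
      refine ⟨Θ₁, Θ₂, fun x => ?_⟩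
      have := h x
      simp; grind
    · rintro ⟨Γ, Δ, h⟩ x
      have := h x
      simp at this; grind

end JKind

/-- The rules with one hypothesis: par and plus. -/
inductive UKind (ι : Type u) (α : Type v) : Type (max u v)
  | par (a : Addr ι) (A B : Formula α)
  | plus (i : Bool) (a : Addr ι) (A B : Formula α)

namespace UKind

/-- The generated formula. -/
def prin : UKind ι α → Occ ι α
  | par a A B => (a, .par A B)
  | plus _ a A B => (a, .plus A B)

/-- The arguments contained in the hypothesis. -/
def args : UKind ι α → OccSet ι α
  | par a A B => {(a.arg false, A), (a.arg true, B)}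
  | plus i a A B => {(a.arg i, cond i B A)}

/-- The rule of a given kind. -/
def Rule : UKind ι α → OccSet ι α → OccSet ι α → Prop
  | par a A B, Θ₁, Θ => ParRule a A B Θ₁ Θ
  | plus i a A B, Θ₁, Θ => PlusRule i a A B Θ₁ Θ

/-- The part of the generated formula that is absent from the hypothesis. -/
def dropped : UKind ι α → Set (Addr ι)
  | par _ _ _ => ∅
  | plus i a _ _ => {w | (a.arg !i).Below w}

theorem refines (k : UKind ι α) : Refines k.args {k.prin} := by
  cases k with
  | par a A B => exact refines_pair ..
  | plus i a A B =>
    refine (refines_pair a A B _).mono ?_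
    cases i <;> simp [args]

/-- Membership form of `Rule`. -/
def Split (k : UKind ι α) (Γ Θ₁ Θ : OccSet ι α) : Prop :=
  ∀ x, (x ∈ Θ₁ ↔ x ∈ Γ ∨ x ∈ k.args) ∧ (x ∈ Θ ↔ x ∈ Γ ∨ x = k.prin) ∧
    ¬ (x ∈ Γ ∧ x ∈ k.args) ∧ ¬ (x ∈ Γ ∧ x = k.prin)

theorem rule_iff {k : UKind ι α} {Θ₁ Θ : OccSet ι α} :
    k.Rule Θ₁ Θ ↔ ∃ Γ, k.Split Γ Θ₁ Θ := by
  cases k <;> simp only [Rule, ParRule, PlusRule, isDisjUnion_iff, Split, args, prin,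
    ← forall_and, Set.mem_singleton_iff] <;>
  exact exists_congr fun Γ => forall_congr' fun x => by grind

end UKind

/-- The data of a with rule. -/
structure AKind (ι : Type u) (α : Type v) : Type (max u v) where
  a : Addr ι
  A : Formula α
  B : Formula α

namespace AKind

/-- The generated formula. -/
def prin (k : AKind ι α) : Occ ι α := (k.a, .amp k.A k.B)

/-- The argument contained in the first hypothesis. -/
def left (k : AKind ι α) : Occ ι α := (k.a.arg false, k.A)

/-- The argument contained in the second hypothesis. -/
def right (k : AKind ι α) : Occ ι α := (k.a.arg true, k.B)

/-- The rule. -/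
def Rule (k : AKind ι α) (Θ₁ Θ₂ Θ : OccSet ι α) : Prop := AmpRule k.a k.A k.B Θ₁ Θ₂ Θ

theorem refines (k : AKind ι α) : Refines ({k.left} ∪ {k.right}) {k.prin} := refines_pair ..

/-- Membership form of `Rule`. -/
def Split (k : AKind ι α) (Γ Θ₁ Θ₂ Θ : OccSet ι α) : Prop :=
  ∀ x, (x ∈ Θ₁ ↔ x ∈ Γ ∨ x = k.left) ∧ (x ∈ Θ₂ ↔ x ∈ Γ ∨ x = k.right) ∧
    (x ∈ Θ ↔ x ∈ Γ ∨ x = k.prin) ∧ ¬ (x ∈ Γ ∧ x = k.left) ∧ ¬ (x ∈ Γ ∧ x = k.right) ∧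
    ¬ (x ∈ Γ ∧ x = k.prin)

theorem rule_iff {k : AKind ι α} {Θ₁ Θ₂ Θ : OccSet ι α} :
    k.Rule Θ₁ Θ₂ Θ ↔ ∃ Γ, k.Split Γ Θ₁ Θ₂ Θ := by
  simp only [Rule, AmpRule, isDisjUnion_iff, Split, left, right, prin,
    ← forall_and, Set.mem_singleton_iff]
  exact exists_congr fun Γ => forall_congr' fun x => by grind

end AKind

/-! ### Hypotheses of rules -/

theorem Refines.disjoint {L M P Q Θ : OccSet ι α} (h : Refines L P) (h' : Refines M Q)
    (hΘ : WellFormed Θ) (hP : P ⊆ Θ) (hQ : Q ⊆ Θ) (hPQ : Disjoint P Q) (x : Occ ι α) :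
    ¬ (x ∈ L ∧ x ∈ M) := fun hx =>
  Set.disjoint_left.1 (hΘ.disjoint_region hP hQ hPQ) (h.2.1 ⟨x, hx.1, .refl _⟩)
    (h'.2.1 ⟨x, hx.2, .refl _⟩)

theorem Refines.region_subset {L P Θ Φ : OccSet ι α} (h : Refines L P) (hP : P ⊆ Θ)
    (hΦ : Φ ⊆ Θ \ P ∪ L) : region Φ ⊆ region Θ := by
  refine (region_mono hΦ).trans ?_
  rw [region_union]
  exact Set.union_subset (region_mono Set.sdiff_subset) (h.2.1.trans (region_mono hP))

namespace JKind

variable {k : JKind ι α} {Θ₁ Θ₂ Θ : OccSet ι α}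

theorem Rule.prin_subset (h : k.Rule Θ₁ Θ₂ Θ) : k.prin ⊆ Θ := by
  obtain ⟨Γ, Δ, h⟩ := rule_iff.1 h
  intro x hx
  have := h x
  grind

theorem Rule.union_subset (h : k.Rule Θ₁ Θ₂ Θ) :
    Θ₁ ∪ Θ₂ ⊆ Θ \ k.prin ∪ (k.left ∪ k.right) := by
  obtain ⟨Γ, Δ, h⟩ := rule_iff.1 h
  intro x hx
  have := h x
  grind

theorem Rule.notMem (h : k.Rule Θ₁ Θ₂ Θ) (hΘ : WellFormed Θ) (x : Occ ι α) :
    x ∈ Θ → ¬ (x ∈ k.left ∨ x ∈ k.right) :=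
  fun hx hx' => k.refines.notMem hΘ h.prin_subset hx' hx

theorem Rule.wellFormed_union (h : k.Rule Θ₁ Θ₂ Θ) (hΘ : WellFormed Θ) :
    WellFormed (Θ₁ ∪ Θ₂) :=
  (k.refines.wellFormed hΘ h.prin_subset).mono h.union_subset

theorem Rule.wellFormed_left (h : k.Rule Θ₁ Θ₂ Θ) (hΘ : WellFormed Θ) : WellFormed Θ₁ :=
  (h.wellFormed_union hΘ).mono Set.subset_union_left

theorem Rule.wellFormed_right (h : k.Rule Θ₁ Θ₂ Θ) (hΘ : WellFormed Θ) : WellFormed Θ₂ :=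
  (h.wellFormed_union hΘ).mono Set.subset_union_right

theorem Rule.disjoint (h : k.Rule Θ₁ Θ₂ Θ) (hΘ : WellFormed Θ) : Disjoint Θ₁ Θ₂ := by
  have hf := h.notMem hΘ
  obtain ⟨Γ, Δ, h⟩ := rule_iff.1 h
  rw [Set.disjoint_left]
  intro x
  have := h x
  have := hf x
  have := k.disjoint_left_right x
  grind

theorem Rule.disjoint_region (h : k.Rule Θ₁ Θ₂ Θ) (hΘ : WellFormed Θ) :
    Disjoint (region Θ₁) (region Θ₂) :=
  (h.wellFormed_union hΘ).disjoint_region Set.subset_union_left Set.subset_union_right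
    (h.disjoint hΘ)

theorem Rule.region_left (h : k.Rule Θ₁ Θ₂ Θ) : region Θ₁ ⊆ region Θ :=
  k.refines.region_subset h.prin_subset (Set.subset_union_left.trans h.union_subset)

theorem Rule.region_right (h : k.Rule Θ₁ Θ₂ Θ) : region Θ₂ ⊆ region Θ :=
  h.flip.region_left

theorem weight_args_le (k : JKind ι α) : weight k.left + weight k.right ≤ weight k.prin := by
  cases k <;> simp [left, right, prin, weight_singleton, weight_empty, Formula.size]; omega

theorem finite_args (k : JKind ι α) : k.left.Finite ∧ k.right.Finite := by
  cases k <;> simp [left, right]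

theorem Rule.weight_le (h : k.Rule Θ₁ Θ₂ Θ) (hΘ : WellFormed Θ) :
    weight Θ₁ + weight Θ₂ ≤ weight Θ := by
  have hp := h.prin_subset
  obtain ⟨Γ, Δ, h⟩ := rule_iff.1 h
  obtain rfl : Θ₁ = Γ ∪ k.left := Set.ext fun x => (h x).1
  obtain rfl : Θ₂ = Δ ∪ k.right := Set.ext fun x => (h x).2.1
  obtain rfl : Θ = Γ ∪ (Δ ∪ k.prin) := Set.ext fun x => (h x).2.2.1
  have hΓ := hΘ.1.subset (Set.subset_union_left)
  have hΔP := hΘ.1.subset (Set.subset_union_right)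
  have hΔ := hΔP.subset Set.subset_union_left
  have hP := hΔP.subset Set.subset_union_right
  rw [weight_union hΓ k.finite_args.1, weight_union hΔ k.finite_args.2, weight_union hΓ hΔP,
    weight_union hΔ hP]
  · have := k.weight_args_le
    omega
  all_goals
    rw [Set.disjoint_left]
    intro x
    have := h x
    grind

theorem Rule.nonempty (h : k.Rule Θ₁ Θ₂ Θ) (h₁ : Θ₁.Nonempty) : Θ.Nonempty := by
  obtain ⟨x, hx⟩ := h₁
  by_contra hΘ
  rw [Set.not_nonempty_iff_eq_empty] at hΘ
  subst hΘ
  cases k with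
  | mix =>
    obtain ⟨Γ, Δ, h⟩ := rule_iff.1 h
    have := h x
    simp [left] at this
    grind
  | _ => simpa [prin] using h.prin_subset

theorem Rule.eq_of_left_empty (h : k.Rule ∅ Θ₂ Θ) : k = mix ∧ Θ₂ = Θ := by
  obtain ⟨Γ, Δ, h⟩ := rule_iff.1 h
  cases k with
  | mix =>
    refine ⟨rfl, Set.ext fun x => ?_⟩
    have := h x
    simp [left, right, prin] at this
    grind
  | tensor a A B => simpa [left] using (h (a.arg false, A)).1
  | tensorFlip a A B => simpa [left] using (h (a.arg true, B)).1

theorem Rule.eq_of_right_empty (h : k.Rule Θ₁ ∅ Θ) : k = mix ∧ Θ₁ = Θ := by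
  have := h.flip.eq_of_left_empty
  refine ⟨?_, this.2⟩
  rw [← k.flip_flip, this.1]; rfl

end JKind

namespace UKind

variable {k : UKind ι α} {Θ₁ Θ : OccSet ι α}

theorem Rule.prin_mem (h : k.Rule Θ₁ Θ) : k.prin ∈ Θ := by
  obtain ⟨Γ, h⟩ := rule_iff.1 h
  have := h k.prin
  grind

theorem Rule.prin_subset (h : k.Rule Θ₁ Θ) : {k.prin} ⊆ Θ :=
  Set.singleton_subset_iff.2 h.prin_mem

theorem Rule.hyp_eq (h : k.Rule Θ₁ Θ) : Θ₁ = Θ \ {k.prin} ∪ k.args := by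
  obtain ⟨Γ, h⟩ := rule_iff.1 h
  ext x
  have := h x
  simp; grind

theorem Rule.notMem (h : k.Rule Θ₁ Θ) (hΘ : WellFormed Θ) (x : Occ ι α) : x ∈ Θ → x ∉ k.args :=
  fun hx hx' => k.refines.notMem hΘ h.prin_subset hx' hx

theorem Rule.wellFormed (h : k.Rule Θ₁ Θ) (hΘ : WellFormed Θ) : WellFormed Θ₁ :=
  (k.refines.wellFormed hΘ h.prin_subset).mono h.hyp_eq.subset

theorem Rule.region_subset (h : k.Rule Θ₁ Θ) : region Θ₁ ⊆ region Θ :=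
  k.refines.region_subset h.prin_subset h.hyp_eq.subset

theorem args_nonempty (k : UKind ι α) : k.args.Nonempty := by
  cases k <;> simp [args]

theorem weight_args_lt (k : UKind ι α) : weight k.args < weight {k.prin} := by
  cases k with
  | par a A B =>
    have : (UKind.par a A B).args = {(a.arg false, A)} ∪ {(a.arg true, B)} := rfl
    rw [this, weight_union (by simp) (by simp) (by simp [Addr.arg])]
    simp [weight_singleton, prin, Formula.size]
  | plus i a A B =>
    cases i <;> simp [args, weight_singleton, prin, Formula.size]

theorem Rule.weight_lt (h : k.Rule Θ₁ Θ) (hΘ : WellFormed Θ) : weight Θ₁ < weight Θ := by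
  have hΘ₁ := h.wellFormed hΘ
  obtain ⟨Γ, h⟩ := rule_iff.1 h
  obtain rfl : Θ₁ = Γ ∪ k.args := Set.ext fun x => (h x).1
  obtain rfl : Θ = Γ ∪ {k.prin} := Set.ext fun x => (h x).2.1
  have hΓ := hΘ.1.subset (Set.subset_union_left)
  rw [weight_union hΓ (hΘ₁.1.subset Set.subset_union_right), weight_union hΓ (by simp)]
  · have := k.weight_args_lt
    omega
  all_goals
    rw [Set.disjoint_left]
    intro x
    have := h x
    grind

end UKind

namespace AKind

variable {k : AKind ι α} {Θ₁ Θ₂ Θ : OccSet ι α}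

theorem Rule.prin_mem (h : k.Rule Θ₁ Θ₂ Θ) : k.prin ∈ Θ := by
  obtain ⟨Γ, h⟩ := rule_iff.1 h
  have := h k.prin
  grind

theorem Rule.prin_subset (h : k.Rule Θ₁ Θ₂ Θ) : {k.prin} ⊆ Θ :=
  Set.singleton_subset_iff.2 h.prin_mem

theorem Rule.left_eq (h : k.Rule Θ₁ Θ₂ Θ) : Θ₁ = Θ \ {k.prin} ∪ {k.left} := by
  obtain ⟨Γ, h⟩ := rule_iff.1 h
  ext x
  have := h x
  simp; grind

theorem Rule.right_eq (h : k.Rule Θ₁ Θ₂ Θ) : Θ₂ = Θ \ {k.prin} ∪ {k.right} := by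
  obtain ⟨Γ, h⟩ := rule_iff.1 h
  ext x
  have := h x
  simp; grind

theorem refines_left (k : AKind ι α) : Refines {k.left} {k.prin} :=
  k.refines.mono Set.subset_union_left

theorem refines_right (k : AKind ι α) : Refines {k.right} {k.prin} :=
  k.refines.mono Set.subset_union_right

theorem Rule.notMem (h : k.Rule Θ₁ Θ₂ Θ) (hΘ : WellFormed Θ) (x : Occ ι α) :
    x ∈ Θ → ¬ (x = k.left ∨ x = k.right) :=
  fun hx hx' => k.refines.notMem hΘ h.prin_subset hx' hx

theorem Rule.wellFormed_left (h : k.Rule Θ₁ Θ₂ Θ) (hΘ : WellFormed Θ) : WellFormed Θ₁ :=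
  h.left_eq ▸ k.refines_left.wellFormed hΘ h.prin_subset

theorem Rule.wellFormed_right (h : k.Rule Θ₁ Θ₂ Θ) (hΘ : WellFormed Θ) : WellFormed Θ₂ :=
  h.right_eq ▸ k.refines_right.wellFormed hΘ h.prin_subset

theorem Rule.region_left (h : k.Rule Θ₁ Θ₂ Θ) : region Θ₁ ⊆ region Θ :=
  k.refines_left.region_subset h.prin_subset h.left_eq.subset

theorem Rule.region_right (h : k.Rule Θ₁ Θ₂ Θ) : region Θ₂ ⊆ region Θ :=
  k.refines_right.region_subset h.prin_subset h.right_eq.subset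

theorem left_ne_right (k : AKind ι α) : k.left ≠ k.right := by
  simp [left, right, Addr.arg]

/-- The subtree of the second argument avoids the first hypothesis. -/
theorem Rule.disjoint_left (h : k.Rule Θ₁ Θ₂ Θ) (hΘ : WellFormed Θ) :
    Disjoint (region Θ₁) (region {k.right}) := by
  refine (k.refines.wellFormed hΘ h.prin_subset).disjoint_region ?_ ?_ ?_
  · rw [h.left_eq]; exact Set.union_subset_union_right _ Set.subset_union_left
  · exact Set.subset_union_right.trans Set.subset_union_right
  · have := h.notMem hΘ k.right
    have := k.left_ne_right
    rw [h.left_eq, Set.disjoint_singleton_right]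
    simp; grind

/-- The subtree of the first argument avoids the second hypothesis. -/
theorem Rule.disjoint_right (h : k.Rule Θ₁ Θ₂ Θ) (hΘ : WellFormed Θ) :
    Disjoint (region Θ₂) (region {k.left}) := by
  refine (k.refines.wellFormed hΘ h.prin_subset).disjoint_region ?_ ?_ ?_
  · rw [h.right_eq]; exact Set.union_subset_union_right _ Set.subset_union_right
  · exact Set.subset_union_left.trans Set.subset_union_right
  · have := h.notMem hΘ k.left
    have := k.left_ne_right
    rw [h.right_eq, Set.disjoint_singleton_right]
    simp; grind

theorem Rule.weight_lt (h : k.Rule Θ₁ Θ₂ Θ) (hΘ : WellFormed Θ) :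
    weight Θ₁ < weight Θ ∧ weight Θ₂ < weight Θ := by
  obtain ⟨Γ, h⟩ := rule_iff.1 h
  obtain rfl : Θ₁ = Γ ∪ {k.left} := Set.ext fun x => (h x).1
  obtain rfl : Θ₂ = Γ ∪ {k.right} := Set.ext fun x => (h x).2.1
  obtain rfl : Θ = Γ ∪ {k.prin} := Set.ext fun x => (h x).2.2.1
  have hΓ := hΘ.1.subset (Set.subset_union_left)
  rw [weight_union hΓ (by simp), weight_union hΓ (by simp), weight_union hΓ (by simp)]
  · simp only [weight_singleton, left, right, prin, Formula.size]
    have := k.A.size_pos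
    have := k.B.size_pos
    omega
  all_goals
    rw [Set.disjoint_left]
    intro x
    have := h x
    grind

end AKind

/-! ### Exchanging two rules -/

theorem exchange_join_un {k : JKind ι α} {l : UKind ι α} {Θ₁ Θ₂ Θ Φ : OccSet ι α}
    (hΘ : WellFormed Θ) (hk : k.Rule Θ₁ Θ₂ Θ) (hl : l.Rule Φ Θ) (hp : l.prin ∈ Θ₁) :
    ∃ Φ₁, l.Rule Φ₁ Θ₁ ∧ k.Rule Φ₁ Θ₂ Φ := by
  have e := hl.hyp_eq
  have f := hk.notMem hΘ
  have g := hl.notMem hΘ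
  have hpΘ := hl.prin_mem
  have hpk : l.prin ∉ k.prin := by
    obtain ⟨Γ, Δ, h⟩ := JKind.rule_iff.1 hk
    have := h l.prin
    have := f l.prin
    grind
  have d := k.refines.disjoint l.refines hΘ hk.prin_subset hl.prin_subset
    (Set.disjoint_singleton_right.2 hpk)
  obtain ⟨Γ, Δ, h⟩ := JKind.rule_iff.1 hk
  refine ⟨Θ₁ \ {l.prin} ∪ l.args, UKind.rule_iff.2 ⟨Θ₁ \ {l.prin}, fun x => ?_⟩,
    JKind.rule_iff.2 ⟨Γ \ {l.prin} ∪ l.args, Δ, fun x => ?_⟩⟩ <;>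
  · have := h x
    have := f x
    have := g x
    have := d x
    have := h l.prin
    have := f l.prin
    subst e
    simp only [Set.mem_union, Set.mem_sdiff, Set.mem_singleton_iff] at *
    grind

theorem exchange_join_amp {k : JKind ι α} {l : AKind ι α} {Θ₁ Θ₂ Θ Φ Ψ : OccSet ι α}
    (hΘ : WellFormed Θ) (hk : k.Rule Θ₁ Θ₂ Θ) (hl : l.Rule Φ Ψ Θ) (hp : l.prin ∈ Θ₁) :
    ∃ Φ₁ Ψ₁, l.Rule Φ₁ Ψ₁ Θ₁ ∧ k.Rule Φ₁ Θ₂ Φ ∧ k.Rule Ψ₁ Θ₂ Ψ := by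
  have e := hl.left_eq
  have e' := hl.right_eq
  have f := hk.notMem hΘ
  have g := hl.notMem hΘ
  have hpΘ := hl.prin_mem
  have hpk : l.prin ∉ k.prin := by
    obtain ⟨Γ, Δ, h⟩ := JKind.rule_iff.1 hk
    have := h l.prin
    have := f l.prin
    grind
  have d := k.refines.disjoint l.refines hΘ hk.prin_subset hl.prin_subset
    (Set.disjoint_singleton_right.2 hpk)
  obtain ⟨Γ, Δ, h⟩ := JKind.rule_iff.1 hk
  refine ⟨Θ₁ \ {l.prin} ∪ {l.left}, Θ₁ \ {l.prin} ∪ {l.right},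
    AKind.rule_iff.2 ⟨Θ₁ \ {l.prin}, fun x => ?_⟩,
    JKind.rule_iff.2 ⟨Γ \ {l.prin} ∪ {l.left}, Δ, fun x => ?_⟩,
    JKind.rule_iff.2 ⟨Γ \ {l.prin} ∪ {l.right}, Δ, fun x => ?_⟩⟩ <;>
  · have := h x
    have := f x
    have := g x
    have := d x
    have := h l.prin
    have := f l.prin
    subst e e'
    simp only [Set.mem_union, Set.mem_sdiff, Set.mem_singleton_iff] at *
    grind

theorem exchange_un_un {k l : UKind ι α} {Θ Φ Ψ : OccSet ι α}
    (hΘ : WellFormed Θ) (hk : k.Rule Φ Θ) (hl : l.Rule Ψ Θ) (hne : k.prin ≠ l.prin) :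
    ∃ Ω, k.Rule Ω Ψ ∧ l.Rule Ω Φ := by
  have e := hk.hyp_eq
  have e' := hl.hyp_eq
  have f := hk.notMem hΘ
  have g := hl.notMem hΘ
  have hpk := hk.prin_mem
  have hpl := hl.prin_mem
  have d := k.refines.disjoint l.refines hΘ hk.prin_subset hl.prin_subset
    (Set.disjoint_singleton.2 hne)
  refine ⟨Θ \ {k.prin, l.prin} ∪ k.args ∪ l.args,
    UKind.rule_iff.2 ⟨Θ \ {k.prin, l.prin} ∪ l.args, fun x => ?_⟩,
    UKind.rule_iff.2 ⟨Θ \ {k.prin, l.prin} ∪ k.args, fun x => ?_⟩⟩ <;>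
  · have := f x
    have := g x
    have := d x
    subst e e'
    simp only [Set.mem_union, Set.mem_sdiff, Set.mem_singleton_iff, Set.mem_insert_iff] at *
    grind

theorem exchange_un_amp {k : UKind ι α} {l : AKind ι α} {Θ Φ Ψ₁ Ψ₂ : OccSet ι α}
    (hΘ : WellFormed Θ) (hk : k.Rule Φ Θ) (hl : l.Rule Ψ₁ Ψ₂ Θ) :
    ∃ Ω₁ Ω₂, k.Rule Ω₁ Ψ₁ ∧ k.Rule Ω₂ Ψ₂ ∧ l.Rule Ω₁ Ω₂ Φ := by
  have hne : k.prin ≠ l.prin := by cases k <;> simp [UKind.prin, AKind.prin]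
  have e := hk.hyp_eq
  have e' := hl.left_eq
  have e'' := hl.right_eq
  have f := hk.notMem hΘ
  have g := hl.notMem hΘ
  have hpk := hk.prin_mem
  have hpl := hl.prin_mem
  have d := k.refines.disjoint l.refines hΘ hk.prin_subset hl.prin_subset
    (Set.disjoint_singleton.2 hne)
  refine ⟨Θ \ {k.prin, l.prin} ∪ k.args ∪ {l.left}, Θ \ {k.prin, l.prin} ∪ k.args ∪ {l.right},
    UKind.rule_iff.2 ⟨Θ \ {k.prin, l.prin} ∪ {l.left}, fun x => ?_⟩,
    UKind.rule_iff.2 ⟨Θ \ {k.prin, l.prin} ∪ {l.right}, fun x => ?_⟩,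
    AKind.rule_iff.2 ⟨Θ \ {k.prin, l.prin} ∪ k.args, fun x => ?_⟩⟩ <;>
  · have := f x
    have := g x
    have := d x
    subst e e' e''
    simp only [Set.mem_insert_iff, Set.mem_union, Set.mem_sdiff, Set.mem_singleton_iff] at *
    grind

theorem exchange_amp_amp {k l : AKind ι α} {Θ Φ₁ Φ₂ Ψ₁ Ψ₂ : OccSet ι α}
    (hΘ : WellFormed Θ) (hk : k.Rule Φ₁ Φ₂ Θ) (hl : l.Rule Ψ₁ Ψ₂ Θ) (hne : k.prin ≠ l.prin) :
    ∃ Ω₁₁ Ω₁₂ Ω₂₁ Ω₂₂, k.Rule Ω₁₁ Ω₂₁ Ψ₁ ∧ k.Rule Ω₁₂ Ω₂₂ Ψ₂ ∧ l.Rule Ω₁₁ Ω₁₂ Φ₁ ∧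
      l.Rule Ω₂₁ Ω₂₂ Φ₂ := by
  have e₁ := hk.left_eq
  have e₂ := hk.right_eq
  have e₃ := hl.left_eq
  have e₄ := hl.right_eq
  have f := hk.notMem hΘ
  have g := hl.notMem hΘ
  have hpk := hk.prin_mem
  have hpl := hl.prin_mem
  have d := k.refines.disjoint l.refines hΘ hk.prin_subset hl.prin_subset
    (Set.disjoint_singleton.2 hne)
  refine ⟨Θ \ {k.prin, l.prin} ∪ {k.left} ∪ {l.left}, Θ \ {k.prin, l.prin} ∪ {k.left} ∪ {l.right},
    Θ \ {k.prin, l.prin} ∪ {k.right} ∪ {l.left}, Θ \ {k.prin, l.prin} ∪ {k.right} ∪ {l.right},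
    AKind.rule_iff.2 ⟨Θ \ {k.prin, l.prin} ∪ {l.left}, fun x => ?_⟩,
    AKind.rule_iff.2 ⟨Θ \ {k.prin, l.prin} ∪ {l.right}, fun x => ?_⟩,
    AKind.rule_iff.2 ⟨Θ \ {k.prin, l.prin} ∪ {k.left}, fun x => ?_⟩,
    AKind.rule_iff.2 ⟨Θ \ {k.prin, l.prin} ∪ {k.right}, fun x => ?_⟩⟩ <;>
  · have := f x
    have := g x
    have := d x
    subst e₁ e₂ e₃ e₄
    simp only [Set.mem_insert_iff, Set.mem_union, Set.mem_sdiff, Set.mem_singleton_iff] at *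
    grind

theorem exchange_join_join {k l : JKind ι α} {Θ₁ Θ₂ Δ₁ Δ₂ Θ : OccSet ι α}
    (hΘ : WellFormed Θ) (hk : k.Rule Θ₁ Θ₂ Θ) (hl : l.Rule Δ₁ Δ₂ Θ) (hkΔ : k.prin ⊆ Δ₁)
    (hlΘ : l.prin ⊆ Θ₁) (hkl : Disjoint k.prin l.prin) :
    ∃ X₁₁ X₂₁ X₁₂ X₂₂ Ψ, k.Rule X₁₁ X₂₁ Δ₁ ∧ JKind.mix.Rule X₁₂ X₂₂ Δ₂ ∧
      l.Rule X₁₁ X₁₂ Θ₁ ∧ JKind.mix.Rule X₂₁ X₂₂ Θ₂ ∧ l.Rule Δ₁ X₁₂ Ψ ∧ k.Rule Θ₁ X₂₁ Ψ ∧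
      JKind.mix.Rule Ψ X₂₂ Θ := by
  have f := hk.notMem hΘ
  have g := hl.notMem hΘ
  have d := k.refines.disjoint l.refines hΘ hk.prin_subset hl.prin_subset hkl
  have c := k.disjoint_left_right
  have c' := l.disjoint_left_right
  rw [Set.disjoint_left] at hkl
  obtain ⟨Γ, Δ, h⟩ := JKind.rule_iff.1 hk
  obtain ⟨Γ', Δ', h'⟩ := JKind.rule_iff.1 hl
  refine ⟨(Γ ∩ Γ') ∪ k.left ∪ l.left, (Δ ∩ Γ') ∪ k.right, (Γ ∩ Δ') ∪ l.right, Δ ∩ Δ', Θ \ (Δ ∩ Δ'),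
    JKind.rule_iff.2 ⟨(Γ ∩ Γ') ∪ l.left, Δ ∩ Γ', fun x => ?_⟩,
    JKind.rule_iff.2 ⟨(Γ ∩ Δ') ∪ l.right, Δ ∩ Δ', fun x => ?_⟩,
    JKind.rule_iff.2 ⟨(Γ ∩ Γ') ∪ k.left, Γ ∩ Δ', fun x => ?_⟩,
    JKind.rule_iff.2 ⟨(Δ ∩ Γ') ∪ k.right, Δ ∩ Δ', fun x => ?_⟩,
    JKind.rule_iff.2 ⟨Γ', Γ ∩ Δ', fun x => ?_⟩,
    JKind.rule_iff.2 ⟨Γ, Δ ∩ Γ', fun x => ?_⟩,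
    JKind.rule_iff.2 ⟨Θ \ (Δ ∩ Δ'), Δ ∩ Δ', fun x => ?_⟩⟩ <;>
  · have := h x
    have := h' x
    have := f x
    have := g x
    have := d x
    have := c x
    have := c' x
    have := @hkl x
    have := @hkΔ x
    have := @hlΘ x
    simp only [Set.mem_union, Set.mem_sdiff, Set.mem_inter_iff, JKind.left, JKind.right,
      JKind.prin, Set.mem_empty_iff_false] at *
    clear h h' f g d c c' hkl hkΔ hlΘ
    grind

theorem exchange_join_self {k : JKind ι α} {Θ₁ Θ₂ Δ₁ Δ₂ Θ : OccSet ι α}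
    (hΘ : WellFormed Θ) (hk : k.Rule Θ₁ Θ₂ Θ) (hl : k.Rule Δ₁ Δ₂ Θ) :
    ∃ X₁₁ X₂₁ X₁₂ X₂₂ Ψ Ψ₁ Ψ₂, JKind.mix.Rule X₁₁ X₂₁ Δ₁ ∧ JKind.mix.Rule X₁₂ X₂₂ Δ₂ ∧
      JKind.mix.Rule X₁₁ X₁₂ Θ₁ ∧ JKind.mix.Rule X₂₁ X₂₂ Θ₂ ∧ k.Rule X₁₁ X₂₂ Ψ ∧
      k.Rule Δ₁ X₂₂ Ψ₁ ∧ JKind.mix.Rule Ψ X₂₁ Ψ₁ ∧ JKind.mix.Rule Ψ₁ X₁₂ Θ ∧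
      k.Rule Θ₁ X₂₂ Ψ₂ ∧ JKind.mix.Rule Ψ X₁₂ Ψ₂ ∧ JKind.mix.Rule Ψ₂ X₂₁ Θ := by
  have f := hk.notMem hΘ
  have c := k.disjoint_left_right
  obtain ⟨Γ, Δ, h⟩ := JKind.rule_iff.1 hk
  obtain ⟨Γ', Δ', h'⟩ := JKind.rule_iff.1 hl
  refine ⟨(Γ ∩ Γ') ∪ k.left, Δ ∩ Γ', Γ ∩ Δ', (Δ ∩ Δ') ∪ k.right,
    (Γ ∩ Γ') ∪ (Δ ∩ Δ') ∪ k.prin, Γ' ∪ (Δ ∩ Δ') ∪ k.prin, Γ ∪ (Δ ∩ Δ') ∪ k.prin,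
    JKind.rule_iff.2 ⟨(Γ ∩ Γ') ∪ k.left, Δ ∩ Γ', fun x => ?_⟩,
    JKind.rule_iff.2 ⟨Γ ∩ Δ', (Δ ∩ Δ') ∪ k.right, fun x => ?_⟩,
    JKind.rule_iff.2 ⟨(Γ ∩ Γ') ∪ k.left, Γ ∩ Δ', fun x => ?_⟩,
    JKind.rule_iff.2 ⟨Δ ∩ Γ', (Δ ∩ Δ') ∪ k.right, fun x => ?_⟩,
    JKind.rule_iff.2 ⟨Γ ∩ Γ', Δ ∩ Δ', fun x => ?_⟩,
    JKind.rule_iff.2 ⟨Γ', Δ ∩ Δ', fun x => ?_⟩,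
    JKind.rule_iff.2 ⟨(Γ ∩ Γ') ∪ (Δ ∩ Δ') ∪ k.prin, Δ ∩ Γ', fun x => ?_⟩,
    JKind.rule_iff.2 ⟨Γ' ∪ (Δ ∩ Δ') ∪ k.prin, Γ ∩ Δ', fun x => ?_⟩,
    JKind.rule_iff.2 ⟨Γ, Δ ∩ Δ', fun x => ?_⟩,
    JKind.rule_iff.2 ⟨(Γ ∩ Γ') ∪ (Δ ∩ Δ') ∪ k.prin, Γ ∩ Δ', fun x => ?_⟩,
    JKind.rule_iff.2 ⟨Γ ∪ (Δ ∩ Δ') ∪ k.prin, Δ ∩ Γ', fun x => ?_⟩⟩ <;>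
  · have := h x
    have := h' x
    have := f x
    have := c x
    simp only [Set.mem_union, Set.mem_inter_iff, JKind.left, JKind.right,
      JKind.prin, Set.mem_empty_iff_false] at *
    clear h h' f c
    grind

/-! ### Proofs by kinds of rules -/

namespace Proof

variable {Θ₁ Θ₂ Θ : OccSet ι α}

/-- The proof ending in a tensor or mix rule. -/
def join : (k : JKind ι α) → k.Ok m → k.Rule Θ₁ Θ₂ Θ → Proof m Θ₁ → Proof m Θ₂ → Proof m Θ
  | .tensor _ _ _, _, h, x, y => .tensor h x y
  | .tensorFlip _ _ _, _, h, x, y => .tensor h y x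
  | .mix, hk, h, x, y => .mix hk h x y

/-- The proof ending in a par or plus rule. -/
def un : (k : UKind ι α) → k.Rule Θ₁ Θ → Proof m Θ₁ → Proof m Θ
  | .par _ _ _, h, x => .par h x
  | .plus _ _ _ _, h, x => .plus h x

/-- The proof ending in a with rule. -/
def withRule (k : AKind ι α) (h : k.Rule Θ₁ Θ₂ Θ) (x : Proof m Θ₁) (y : Proof m Θ₂) : Proof m Θ :=
  .amp h x y

@[elab_as_elim]
theorem kindInduction {motive : ∀ {Θ : OccSet ι α}, Proof m Θ → Prop}
    (ax : ∀ {Θ : OccSet ι α} (a b : Addr ι) (P : α) (h : AxRule a b P Θ),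
      motive (.ax h : Proof m Θ))
    (join : ∀ {Θ₁ Θ₂ Θ : OccSet ι α} (k : JKind ι α) (hk : k.Ok m) (h : k.Rule Θ₁ Θ₂ Θ)
      (x : Proof m Θ₁) (y : Proof m Θ₂), motive x → motive y → motive (join k hk h x y))
    (un : ∀ {Θ₁ Θ : OccSet ι α} (k : UKind ι α) (h : k.Rule Θ₁ Θ) (x : Proof m Θ₁),
      motive x → motive (un k h x))
    (withRule : ∀ {Θ₁ Θ₂ Θ : OccSet ι α} (k : AKind ι α) (h : k.Rule Θ₁ Θ₂ Θ)
      (x : Proof m Θ₁) (y : Proof m Θ₂), motive x → motive y → motive (withRule k h x y))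
    {Θ : OccSet ι α} (π : Proof m Θ) : motive π := by
  induction π with
  | ax h => exact ax _ _ _ h
  | @tensor a A B _ _ _ h x y hx hy => exact join (.tensor a A B) trivial h x y hx hy
  | mix hm h x y hx hy => exact join .mix hm h x y hx hy
  | @par a A B _ _ h x hx => exact un (.par a A B) h x hx
  | @plus i a A B _ _ h x hx => exact un (.plus i a A B) h x hx
  | @amp a A B _ _ _ h x y hx hy => exact withRule ⟨a, A, B⟩ h x y hx hy

end Proof

/-! ### Conversions -/

namespace Convertible

variable {Θ₁ Θ₂ Θ₃ Θ₄ Φ Φ₁ Φ₂ Ψ Ψ₁ Ψ₂ Θ : OccSet ι α}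

theorem refl (π : Proof m Θ) : Convertible π π := Relation.EqvGen.refl _

theorem symm {π π' : Proof m Θ} (h : Convertible π π') : Convertible π' π :=
  Relation.EqvGen.symm _ _ h

theorem trans {π π' π'' : Proof m Θ} (h : Convertible π π') (h' : Convertible π' π'') :
    Convertible π π'' := Relation.EqvGen.trans _ _ _ h h'

theorem of_commutes {π π' : Proof m Θ} (h : Commutes π π') : Convertible π π' :=
  .rel _ _ (.commute h)

theorem map {f : Proof m Θ → Proof m Φ} (hf : ∀ {x x'}, Step x x' → Step (f x) (f x'))
    {x x' : Proof m Θ} (h : Convertible x x') : Convertible (f x) (f x') := by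
  induction h with
  | rel x y h => exact .rel _ _ (hf h)
  | refl x => exact refl _
  | symm x y _ ih => exact ih.symm
  | trans x y z _ _ ih ih' => exact ih.trans ih'

theorem join (k : JKind ι α) (hk : k.Ok m) (h : k.Rule Θ₁ Θ₂ Θ) {x x' : Proof m Θ₁}
    {y y' : Proof m Θ₂} (hx : Convertible x x') (hy : Convertible y y') :
    Convertible (.join k hk h x y) (.join k hk h x' y') := by
  cases k with
  | tensor a A B =>
    exact (map (f := fun x => .tensor h x y) (.tensor_left h _) hx).trans
      (map (f := fun y => .tensor h x' y) (.tensor_right h _) hy)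
  | tensorFlip a A B =>
    exact (map (f := fun x => .tensor h y x) (.tensor_right h _) hx).trans
      (map (f := fun y => .tensor h y x') (.tensor_left h _) hy)
  | mix =>
    exact (map (f := fun x => .mix hk h x y) (.mix_left hk h _) hx).trans
      (map (f := fun y => .mix hk h x' y) (.mix_right hk h _) hy)

theorem un (k : UKind ι α) (h : k.Rule Θ₁ Θ) {x x' : Proof m Θ₁} (hx : Convertible x x') :
    Convertible (.un k h x) (.un k h x') := by
  cases k with
  | par a A B => exact map (f := fun x => .par h x) (.par h) hx
  | plus i a A B => exact map (f := fun x => .plus h x) (.plus h) hx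

theorem withRule (k : AKind ι α) (h : k.Rule Θ₁ Θ₂ Θ) {x x' : Proof m Θ₁}
    {y y' : Proof m Θ₂} (hx : Convertible x x') (hy : Convertible y y') :
    Convertible (.withRule k h x y) (.withRule k h x' y') :=
  (map (f := fun x => .amp h x y) (.amp_left h _) hx).trans
    (map (f := fun y => .amp h x' y) (.amp_right h _) hy)

theorem join_flip (k : JKind ι α) (hk : k.Ok m) (h : k.Rule Θ₁ Θ₂ Θ) (x : Proof m Θ₁)
    (y : Proof m Θ₂) : Convertible (.join k hk h x y) (.join k.flip hk.flip h.flip y x) := by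
  cases k with
  | mix => exact .rel _ _ (.mix_swap hk x y h _)
  | _ => exact refl _

theorem join_un (k : JKind ι α) (l : UKind ι α) (hk : k.Ok m) (h : k.Rule Φ₁ Θ₂ Θ)
    (h₁ : l.Rule Θ₁ Φ₁) (h' : l.Rule Ψ Θ) (h₁' : k.Rule Θ₁ Θ₂ Ψ) (x : Proof m Θ₁)
    (y : Proof m Θ₂) :
    Convertible (.join k hk h (.un l h₁ x) y) (.un l h' (.join k hk h₁' x y)) := by
  cases k with
  | tensor a A B =>
    cases l with
    | par => exact of_commutes (.par_tensor_left ..)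
    | plus => exact of_commutes (.plus_tensor_left ..)
  | tensorFlip a A B =>
    cases l with
    | par => exact of_commutes (.par_tensor ..)
    | plus => exact of_commutes (.plus_tensor ..)
  | mix =>
    refine (join_flip .mix hk h _ _).trans (.trans ?_ (un l h' (join_flip .mix hk h₁' _ _).symm))
    cases l with
    | par => exact of_commutes (.par_mix ..)
    | plus => exact of_commutes (.plus_mix ..)

theorem join_with (k : JKind ι α) (l : AKind ι α) (hk : k.Ok m) (h : k.Rule Φ Θ₃ Θ)
    (h₁ : l.Rule Θ₁ Θ₂ Φ) (h' : l.Rule Ψ₁ Ψ₂ Θ) (h₁' : k.Rule Θ₁ Θ₃ Ψ₁) (h₂' : k.Rule Θ₂ Θ₃ Ψ₂)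
    (x : Proof m Θ₁) (y : Proof m Θ₂) (z : Proof m Θ₃) :
    Convertible (.join k hk h (.withRule l h₁ x y) z)
      (.withRule l h' (.join k hk h₁' x z) (.join k hk h₂' y z)) := by
  cases k with
  | tensor a A B => exact of_commutes (.amp_tensor_left ..)
  | tensorFlip a A B => exact of_commutes (.amp_tensor ..)
  | mix =>
    refine (join_flip .mix hk h _ _).trans (.trans ?_ (withRule l h'
      (join_flip .mix hk h₁' _ _).symm (join_flip .mix hk h₂' _ _).symm))
    exact of_commutes (.amp_mix ..)

theorem un_un (k l : UKind ι α) (h : k.Rule Φ Θ) (h₁ : l.Rule Θ₁ Φ) (h' : l.Rule Ψ Θ)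
    (h₁' : k.Rule Θ₁ Ψ) (x : Proof m Θ₁) :
    Convertible (.un k h (.un l h₁ x)) (.un l h' (.un k h₁' x)) := by
  cases k <;> cases l
  · exact of_commutes (.par_par ..)
  · exact of_commutes (.plus_par ..)
  · exact (of_commutes (.plus_par ..)).symm
  · exact of_commutes (.plus_plus ..)

theorem with_un (k : AKind ι α) (l : UKind ι α) (h : k.Rule Φ₁ Φ₂ Θ) (h₁ : l.Rule Θ₁ Φ₁)
    (h₂ : l.Rule Θ₂ Φ₂) (h' : l.Rule Ψ Θ) (h₁' : k.Rule Θ₁ Θ₂ Ψ) (x : Proof m Θ₁)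
    (y : Proof m Θ₂) :
    Convertible (.withRule k h (.un l h₁ x) (.un l h₂ y)) (.un l h' (.withRule k h₁' x y)) := by
  cases l
  · exact of_commutes (.par_amp ..)
  · exact of_commutes (.plus_amp ..)

theorem with_with (k l : AKind ι α) (h : k.Rule Φ₁ Φ₂ Θ) (h₁ : l.Rule Θ₁ Θ₂ Φ₁)
    (h₂ : l.Rule Θ₃ Θ₄ Φ₂) (h' : l.Rule Ψ₁ Ψ₂ Θ) (h₁' : k.Rule Θ₁ Θ₃ Ψ₁)
    (h₂' : k.Rule Θ₂ Θ₄ Ψ₂) (x : Proof m Θ₁) (y : Proof m Θ₂) (z : Proof m Θ₃)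
    (w : Proof m Θ₄) :
    Convertible (.withRule k h (.withRule l h₁ x y) (.withRule l h₂ z w))
      (.withRule l h' (.withRule k h₁' x z) (.withRule k h₂' y w)) :=
  of_commutes (.amp_amp ..)

theorem join_join (k l : JKind ι α) (hk : k.Ok m) (hl : l.Ok m) (h : k.Rule Θ₁ Φ Θ)
    (h₁ : l.Rule Θ₂ Θ₃ Φ) (h' : l.Rule Ψ Θ₃ Θ) (h₁' : k.Rule Θ₁ Θ₂ Ψ) (x : Proof m Θ₁)
    (y : Proof m Θ₂) (z : Proof m Θ₃) :
    Convertible (.join k hk h x (.join l hl h₁ y z)) (.join l hl h' (.join k hk h₁' x y) z) := by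
  cases k with
  | tensor =>
    cases l with
    | tensor => exact of_commutes (.tensor_tensor ..)
    | tensorFlip => exact of_commutes (.tensor_tensor_right ..)
    | mix =>
      refine (join (.tensor ..) hk h (refl x) (join_flip .mix hl h₁ y z)).trans
        (.trans ?_ (join_flip .mix hl h' _ _).symm)
      exact (of_commutes (.tensor_mix_right ..)).symm
  | tensorFlip =>
    cases l with
    | tensor => exact of_commutes (.tensor_tensor_left ..)
    | tensorFlip => exact (of_commutes (.tensor_tensor ..)).symm
    | mix =>
      refine (join (.tensorFlip ..) hk h (refl x) (join_flip .mix hl h₁ y z)).trans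
        (.trans ?_ (join_flip .mix hl h' _ _).symm)
      exact (of_commutes (.tensor_mix ..)).symm
  | mix =>
    cases l with
    | tensor => exact of_commutes (.tensor_mix ..)
    | tensorFlip => exact of_commutes (.tensor_mix_right ..)
    | mix => exact of_commutes (.mix_mix ..)

end Convertible

/-! ### Nets -/

/-- The linkings obtained by joining linkings of two nets. -/
def joinNet (θ θ' : Set (Linking ι α)) : Set (Linking ι α) :=
  {l | ∃ l₁ ∈ θ, ∃ l₂ ∈ θ', l = l₁ ∪ l₂}

theorem joinNet_comm (θ θ' : Set (Linking ι α)) : joinNet θ θ' = joinNet θ' θ := by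
  ext l
  constructor <;> rintro ⟨a, ha, b, hb, rfl⟩ <;> exact ⟨b, hb, a, ha, Set.union_comm ..⟩

theorem joinNet_assoc (θ θ' θ'' : Set (Linking ι α)) :
    joinNet θ (joinNet θ' θ'') = joinNet (joinNet θ θ') θ'' := by
  ext l
  constructor
  · rintro ⟨a, ha, _, ⟨b, hb, c, hc, rfl⟩, rfl⟩
    exact ⟨_, ⟨a, ha, b, hb, rfl⟩, c, hc, (Set.union_assoc ..).symm⟩
  · rintro ⟨_, ⟨a, ha, b, hb, rfl⟩, c, hc, rfl⟩
    exact ⟨a, ha, _, ⟨b, hb, c, hc, rfl⟩, Set.union_assoc ..⟩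

theorem joinNet_union (θ θ' θ'' : Set (Linking ι α)) :
    joinNet θ (θ' ∪ θ'') = joinNet θ θ' ∪ joinNet θ θ'' := by
  ext l
  constructor
  · rintro ⟨a, ha, b, hb | hb, rfl⟩
    · exact .inl ⟨a, ha, b, hb, rfl⟩
    · exact .inr ⟨a, ha, b, hb, rfl⟩
  · rintro (⟨a, ha, b, hb, rfl⟩ | ⟨a, ha, b, hb, rfl⟩)
    · exact ⟨a, ha, b, .inl hb, rfl⟩
    · exact ⟨a, ha, b, .inr hb, rfl⟩

theorem union_joinNet (θ θ' θ'' : Set (Linking ι α)) :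
    joinNet (θ' ∪ θ'') θ = joinNet θ' θ ∪ joinNet θ'' θ := by
  rw [joinNet_comm, joinNet_union, joinNet_comm θ, joinNet_comm θ]

namespace Proof

variable {Θ₁ Θ₂ Θ : OccSet ι α}

theorem net_tensor {a : Addr ι} {A B : Formula α} (h : TensorRule a A B Θ₁ Θ₂ Θ)
    (x : Proof m Θ₁) (y : Proof m Θ₂) : (Proof.tensor h x y).net = joinNet x.net y.net := rfl

theorem net_mix (hm : m = true) (h : MixRule Θ₁ Θ₂ Θ)
    (x : Proof m Θ₁) (y : Proof m Θ₂) : (Proof.mix hm h x y).net = joinNet x.net y.net := rfl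

theorem net_par {a : Addr ι} {A B : Formula α} (h : ParRule a A B Θ₁ Θ)
    (x : Proof m Θ₁) : (Proof.par h x).net = x.net := rfl

theorem net_plus {i : Bool} {a : Addr ι} {A B : Formula α} (h : PlusRule i a A B Θ₁ Θ)
    (x : Proof m Θ₁) : (Proof.plus h x).net = x.net := rfl

theorem net_amp {a : Addr ι} {A B : Formula α} (h : AmpRule a A B Θ₁ Θ₂ Θ)
    (x : Proof m Θ₁) (y : Proof m Θ₂) : (Proof.amp h x y).net = x.net ∪ y.net := rfl

theorem net_join (k : JKind ι α) (hk : k.Ok m) (h : k.Rule Θ₁ Θ₂ Θ) (x : Proof m Θ₁)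
    (y : Proof m Θ₂) : (join k hk h x y).net = joinNet x.net y.net := by
  cases k with
  | tensorFlip => exact joinNet_comm ..
  | _ => rfl

theorem net_un (k : UKind ι α) (h : k.Rule Θ₁ Θ) (x : Proof m Θ₁) :
    (un k h x).net = x.net := by
  cases k <;> rfl

theorem net_withRule (k : AKind ι α) (h : k.Rule Θ₁ Θ₂ Θ) (x : Proof m Θ₁) (y : Proof m Θ₂) :
    (withRule k h x y).net = x.net ∪ y.net := rfl

end Proof

theorem Commutes.net_eq {Θ : OccSet ι α} {π π' : Proof m Θ} (h : Commutes π π') :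
    π.net = π'.net := by
  cases h <;> simp only [Proof.net_tensor, Proof.net_mix, Proof.net_par, Proof.net_plus,
    Proof.net_amp, joinNet_assoc, joinNet_union, union_joinNet]
  case tensor_tensor_right x y z _ _ _ _ => rw [joinNet_comm x.net]
  case tensor_tensor_left x y z _ _ _ _ =>
    rw [← joinNet_assoc, joinNet_comm z.net, joinNet_assoc]
  case amp_amp => exact Set.union_union_union_comm ..
  case tensor_mix_right x y z _ _ _ _ => rw [joinNet_comm x.net]

theorem Step.net_eq {Θ : OccSet ι α} {π π' : Proof m Θ} (h : Step π π') : π.net = π'.net := by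
  induction h with
  | commute h => exact h.net_eq
  | mix_swap hm x y h k => exact joinNet_comm ..
  | _ => simp only [Proof.net_tensor, Proof.net_mix, Proof.net_par, Proof.net_plus,
      Proof.net_amp, *]

theorem Convertible.net_eq {Θ : OccSet ι α} {π π' : Proof m Θ} (h : Convertible π π') :
    π.net = π'.net := by
  induction h with
  | rel x y h => exact h.net_eq
  | refl x => rfl
  | symm x y _ ih => exact ih.symm
  | trans x y z _ _ ih ih' => exact ih.trans ih'

/-! ### Linkings of a proof and its sequent -/

/-- All leaves of the link lie in `R`. -/
def Inside (R : Set (Addr ι)) (l : Link ι α) : Prop := ∀ e ∈ l, e.1 ∈ R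

/-- All links of the linkings lie in `R`. -/
def NetOn (θ : Set (Linking ι α)) (R : Set (Addr ι)) : Prop := ∀ s ∈ θ, ∀ l ∈ s, Inside R l

/-- Every linking has a leaf in `R`. -/
def NetHits (θ : Set (Linking ι α)) (R : Set (Addr ι)) : Prop :=
  ∀ s ∈ θ, ∃ l ∈ s, ∃ e ∈ l, e.1 ∈ R

theorem Inside.mono {R R' : Set (Addr ι)} {l : Link ι α} (h : Inside R l) (hR : R ⊆ R') :
    Inside R' l := fun e he => hR (h e he)

theorem Inside.not_disjoint {R R' : Set (Addr ι)} {l : Link ι α} (h : Inside R l)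
    (h' : Inside R' l) : ¬ Disjoint R R' := by
  induction l using Sym2.ind with
  | _ x y =>
    exact fun hd => Set.disjoint_left.1 hd
      (h x (Sym2.mem_mk_left x y)) (h' x (Sym2.mem_mk_left x y))

namespace Proof

theorem net_nonempty {Θ : OccSet ι α} (π : Proof m Θ) : π.net.Nonempty := by
  induction π using kindInduction with
  | ax a b P h => exact ⟨_, rfl⟩
  | join k hk h x y hx hy =>
    rw [net_join]
    obtain ⟨s, hs⟩ := hx
    obtain ⟨t, ht⟩ := hy
    exact ⟨_, s, hs, t, ht, rfl⟩
  | un k h x hx => rwa [net_un]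
  | withRule k h x y hx hy => exact hx.mono Set.subset_union_left

theorem nonempty {Θ : OccSet ι α} (π : Proof m Θ) : Θ.Nonempty := by
  induction π using kindInduction with
  | ax a b P h => exact ⟨(a, .var P), h.2 ▸ .inl rfl⟩
  | join k hk h x y hx hy => exact h.nonempty hx
  | un k h x hx => exact ⟨_, h.prin_mem⟩
  | withRule k h x y hx hy => exact ⟨_, h.prin_mem⟩

theorem netOn {Θ : OccSet ι α} (π : Proof m Θ) : NetOn π.net (region Θ) := by
  induction π using kindInduction with
  | ax a b P h =>
    rintro _ rfl _ rfl e he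
    rw [← h.2]
    rcases Sym2.mem_iff.1 he with rfl | rfl
    · exact ⟨_, .inl rfl, .refl _⟩
    · exact ⟨_, .inr rfl, .refl _⟩
  | join k hk h x y hx hy =>
    rw [net_join]
    rintro _ ⟨s, hs, t, ht, rfl⟩ l (hl | hl)
    · exact (hx s hs l hl).mono h.region_left
    · exact (hy t ht l hl).mono h.region_right
  | un k h x hx =>
    rw [net_un]
    exact fun s hs l hl => (hx s hs l hl).mono h.region_subset
  | withRule k h x y hx hy =>
    rintro s (hs | hs) l hl
    · exact (hx s hs l hl).mono h.region_left
    · exact (hy s hs l hl).mono h.region_right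

theorem netHits {Θ : OccSet ι α} (π : Proof m Θ) {o : Occ ι α} (ho : o ∈ Θ) :
    NetHits π.net (region {o}) := by
  have mono : ∀ {o o' : Occ ι α} {θ : Set (Linking ι α)}, NetHits θ (region {o}) →
      o'.1.Below o.1 → NetHits θ (region {o'}) := by
    intro o o' θ h hb s hs
    obtain ⟨l, hl, e, he, _, rfl, hw⟩ := h s hs
    exact ⟨l, hl, e, he, _, rfl, hb.trans hw⟩
  induction π using kindInduction generalizing o with
  | ax a b P h =>
    rintro _ rfl
    rw [← h.2] at ho
    rcases ho with rfl | rfl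
    · exact ⟨_, rfl, _, Sym2.mem_mk_left .., _, rfl, .refl _⟩
    · exact ⟨_, rfl, _, Sym2.mem_mk_right .., _, rfl, .refl _⟩
  | @join Θ₁ Θ₂ _ k hk h x y hx hy =>
    rw [net_join]
    have left : ∀ {o' : Occ ι α}, o' ∈ Θ₁ → o.1.Below o'.1 → NetHits (joinNet x.net y.net)
        (region {o}) := by
      rintro o' ho' hb _ ⟨s, hs, t, ht, rfl⟩
      obtain ⟨l, hl, hr⟩ := mono (hx ho') hb s hs
      exact ⟨l, .inl hl, hr⟩
    have right : ∀ {o' : Occ ι α}, o' ∈ Θ₂ → o.1.Below o'.1 → NetHits (joinNet x.net y.net)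
        (region {o}) := by
      rintro o' ho' hb _ ⟨s, hs, t, ht, rfl⟩
      obtain ⟨l, hl, hr⟩ := mono (hy ho') hb t ht
      exact ⟨l, .inr hl, hr⟩
    obtain ⟨Γ, Δ, h⟩ := JKind.rule_iff.1 h
    rcases (h o).2.2.1.1 ho with h' | h' | h'
    · exact left ((h o).1.2 (.inl h')) (.refl _)
    · exact right ((h o).2.1.2 (.inl h')) (.refl _)
    · cases k with
      | tensor a A B =>
        obtain rfl := h'
        exact left ((h (a.arg false, A)).1.2 (.inr rfl)) (Addr.below_arg ..)
      | tensorFlip a A B =>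
        obtain rfl := h'
        exact right ((h (a.arg false, A)).2.1.2 (.inr rfl)) (Addr.below_arg ..)
      | mix => exact h'.elim
  | un k h x hx =>
    rw [net_un]
    obtain ⟨Γ, h⟩ := UKind.rule_iff.1 h
    rcases (h o).2.1.1 ho with h' | rfl
    · exact hx ((h o).1.2 (.inl h'))
    · cases k with
      | par a A B =>
        exact mono (hx ((h (a.arg false, A)).1.2 (.inr (.inl rfl)))) (Addr.below_arg ..)
      | plus i a A B =>
        exact mono (hx ((h (a.arg i, cond i B A)).1.2 (.inr rfl))) (Addr.below_arg ..)
  | withRule k h x y hx hy =>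
    obtain ⟨Γ, h⟩ := AKind.rule_iff.1 h
    rcases (h o).2.2.1.1 ho with h' | rfl
    · rintro s (hs | hs)
      · exact hx ((h o).1.2 (.inl h')) s hs
      · exact hy ((h o).2.1.2 (.inl h')) s hs
    · rintro s (hs | hs)
      · exact mono (hx ((h k.left).1.2 (.inr rfl))) (Addr.below_arg ..) s hs
      · exact mono (hy ((h k.right).2.1.2 (.inr rfl))) (Addr.below_arg ..) s hs

end Proof

/-! ### Moving a par, plus or with rule to the root -/

theorem JKind.Rule.mem_or_mem {k : JKind ι α} {Θ₁ Θ₂ Θ : OccSet ι α} (h : k.Rule Θ₁ Θ₂ Θ)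
    {o : Occ ι α} (ho : o ∈ Θ) (hk : o ∉ k.prin) : o ∈ Θ₁ ∨ o ∈ Θ₂ := by
  obtain ⟨Γ, Δ, h⟩ := rule_iff.1 h
  have := h o
  grind

theorem JKind.Rule.prin_mem_or_un {k : JKind ι α} {Θ₁ Θ₂ Θ : OccSet ι α} (h : k.Rule Θ₁ Θ₂ Θ)
    {l : UKind ι α} {Φ : OccSet ι α} (hl : l.Rule Φ Θ) : l.prin ∈ Θ₁ ∨ l.prin ∈ Θ₂ :=
  h.mem_or_mem hl.prin_mem (by cases k <;> cases l <;> simp [prin, UKind.prin])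

theorem JKind.Rule.prin_mem_or_with {k : JKind ι α} {Θ₁ Θ₂ Θ : OccSet ι α}
    (h : k.Rule Θ₁ Θ₂ Θ) {l : AKind ι α} {Φ Ψ : OccSet ι α} (hl : l.Rule Φ Ψ Θ) :
    l.prin ∈ Θ₁ ∨ l.prin ∈ Θ₂ :=
  h.mem_or_mem hl.prin_mem (by cases k <;> simp [prin, AKind.prin])

/-- No leaf of the linkings lies in `R`. -/
def NetAvoids (θ : Set (Linking ι α)) (R : Set (Addr ι)) : Prop :=
  ∀ s ∈ θ, ∀ l ∈ s, ∀ e ∈ l, e.1 ∉ R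

theorem NetAvoids.mono {θ θ' : Set (Linking ι α)} {R : Set (Addr ι)} (h : NetAvoids θ R)
    (hθ : θ' ⊆ θ) : NetAvoids θ' R := fun s hs => h s (hθ hs)

theorem NetAvoids.of_joinNet {θ θ' : Set (Linking ι α)} {R : Set (Addr ι)}
    (h : NetAvoids (joinNet θ θ') R) (hθ' : θ'.Nonempty) : NetAvoids θ R := by
  obtain ⟨t, ht⟩ := hθ'
  exact fun s hs l hl => h _ ⟨s, hs, t, ht, rfl⟩ l (.inl hl)

theorem lower_un_join {k : UKind ι α} {l : JKind ι α} {Δ₁ Δ₂ Θ Φ : OccSet ι α}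
    (hΘ : WellFormed Θ) (hl : l.Ok m) (h : l.Rule Δ₁ Δ₂ Θ) (x : Proof m Δ₁) (y : Proof m Δ₂)
    (hk : k.Rule Φ Θ) (hp : k.prin ∈ Δ₁)
    (ih : ∀ {Φ₁ : OccSet ι α} (h₁ : k.Rule Φ₁ Δ₁), ∃ x', Convertible x (.un k h₁ x')) :
    ∃ z, Convertible (.join l hl h x y) (.un k hk z) := by
  obtain ⟨Φ₁, h₁, h₂⟩ := exchange_join_un hΘ h hk hp
  obtain ⟨x', hx'⟩ := ih h₁
  exact ⟨.join l hl h₂ x' y, (hx'.join l hl h (.refl y)).trans (.join_un ..)⟩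

theorem lower_with_join {k : AKind ι α} {l : JKind ι α} {Δ₁ Δ₂ Θ Φ Ψ : OccSet ι α}
    (hΘ : WellFormed Θ) (hl : l.Ok m) (h : l.Rule Δ₁ Δ₂ Θ) (x : Proof m Δ₁) (y : Proof m Δ₂)
    (hk : k.Rule Φ Ψ Θ) (hp : k.prin ∈ Δ₁)
    (ih : ∀ {Φ₁ Ψ₁ : OccSet ι α} (h₁ : k.Rule Φ₁ Ψ₁ Δ₁),
      ∃ x' x'', Convertible x (.withRule k h₁ x' x'')) :
    ∃ z w, Convertible (.join l hl h x y) (.withRule k hk z w) := by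
  obtain ⟨Φ₁, Ψ₁, h₁, h₂, h₃⟩ := exchange_join_amp hΘ h hk hp
  obtain ⟨x', x'', hx'⟩ := ih h₁
  exact ⟨.join l hl h₂ x' y, .join l hl h₃ x'' y,
    (hx'.join l hl h (.refl y)).trans (.join_with ..)⟩

theorem UKind.Rule.unique {k : UKind ι α} {Θ₁ Θ₂ Θ : OccSet ι α} (h : k.Rule Θ₁ Θ)
    (h' : k.Rule Θ₂ Θ) : Θ₁ = Θ₂ := h.hyp_eq.trans h'.hyp_eq.symm

/-- A par rule, and a plus rule whose absent argument is not linked, can be moved to the root. -/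
theorem lower_un {Θ : OccSet ι α} (π : Proof m Θ) (hΘ : WellFormed Θ) {k : UKind ι α}
    {Φ : OccSet ι α} (hk : k.Rule Φ Θ) (hd : NetAvoids π.net k.dropped) :
    ∃ x, Convertible π (.un k hk x) := by
  induction π using Proof.kindInduction generalizing Φ with
  | ax a b P h =>
    have := hk.prin_mem
    rw [← h.2] at this
    cases k <;> simp [UKind.prin] at this
  | join l hl h x y hx hy =>
    rw [Proof.net_join] at hd
    have hdx := hd.of_joinNet y.net_nonempty
    rw [joinNet_comm] at hd
    have hdy := hd.of_joinNet x.net_nonempty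
    rcases h.prin_mem_or_un hk with hp | hp
    · exact lower_un_join hΘ hl h x y hk hp fun h₁ => hx (h.wellFormed_left hΘ) h₁ hdx
    · obtain ⟨z, hz⟩ := lower_un_join hΘ hl.flip h.flip y x hk hp
        fun h₁ => hy (h.wellFormed_right hΘ) h₁ hdy
      exact ⟨z, (Convertible.join_flip ..).trans hz⟩
  | un l h x hx =>
    rw [Proof.net_un] at hd
    by_cases hkl : k.prin = l.prin
    · by_cases hkl' : k = l
      · subst hkl'
        obtain rfl := h.unique hk
        exact ⟨x, .refl _⟩
      · exfalso
        cases k with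
        | par a A B => cases l <;> simp_all [UKind.prin]
        | plus i a A B =>
          cases l with
          | par => simp_all [UKind.prin]
          | plus j a' A' B' =>
            simp only [UKind.prin, Prod.mk.injEq, Formula.plus.injEq] at hkl
            obtain ⟨rfl, rfl, rfl⟩ := hkl
            obtain rfl : j = !i := by
              cases i <;> cases j <;> simp_all
            have hm := h.hyp_eq.superset (Set.mem_union_right _
              (Set.mem_singleton (a.arg !i, cond (!i) B A)))
            obtain ⟨s, hs⟩ := x.net_nonempty
            obtain ⟨l, hl, e, he, _, rfl, hw⟩ := x.netHits hm s hs
            exact hd s hs l hl e he hw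
    · obtain ⟨Ω, h₁, h₂⟩ := exchange_un_un hΘ hk h hkl
      obtain ⟨x', hx'⟩ := hx (h.wellFormed hΘ) h₁ hd
      exact ⟨.un l h₂ x', (hx'.un l h).trans (.un_un ..)⟩
  | withRule l h x y hx hy =>
    obtain ⟨Ω₁, Ω₂, h₁, h₂, h₃⟩ := exchange_un_amp hΘ hk h
    obtain ⟨x', hx'⟩ := hx (h.wellFormed_left hΘ) h₁ (hd.mono Set.subset_union_left)
    obtain ⟨y', hy'⟩ := hy (h.wellFormed_right hΘ) h₂ (hd.mono Set.subset_union_right)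
    exact ⟨.withRule l h₃ x' y', (hx'.withRule l h hy').trans (.with_un ..)⟩

/-- A with rule can be moved to the root. -/
theorem lower_with {Θ : OccSet ι α} (π : Proof m Θ) (hΘ : WellFormed Θ) {k : AKind ι α}
    {Φ Ψ : OccSet ι α} (hk : k.Rule Φ Ψ Θ) : ∃ x y, Convertible π (.withRule k hk x y) := by
  induction π using Proof.kindInduction generalizing Φ Ψ with
  | ax a b P h =>
    have := hk.prin_mem
    rw [← h.2] at this
    simp [AKind.prin] at this
  | join l hl h x y hx hy =>
    rcases h.prin_mem_or_with hk with hp | hp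
    · exact lower_with_join hΘ hl h x y hk hp fun h₁ => hx (h.wellFormed_left hΘ) h₁
    · obtain ⟨z, w, hz⟩ := lower_with_join hΘ hl.flip h.flip y x hk hp
        fun h₁ => hy (h.wellFormed_right hΘ) h₁
      exact ⟨z, w, (Convertible.join_flip ..).trans hz⟩
  | un l h x hx =>
    obtain ⟨Ω₁, Ω₂, h₁, h₂, h₃⟩ := exchange_un_amp hΘ h hk
    obtain ⟨x', y', hx'⟩ := hx (h.wellFormed hΘ) h₃
    exact ⟨.un l h₁ x', .un l h₂ y', (hx'.un l h).trans (Convertible.with_un ..).symm⟩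
  | withRule l h x y hx hy =>
    by_cases hkl : k.prin = l.prin
    · obtain rfl : k = l := by
        cases k; cases l
        simp only [AKind.prin, Prod.mk.injEq, Formula.amp.injEq] at hkl
        simpa using hkl
      obtain rfl := h.left_eq.trans hk.left_eq.symm
      obtain rfl := h.right_eq.trans hk.right_eq.symm
      exact ⟨x, y, .refl _⟩
    · obtain ⟨Ω₁₁, Ω₁₂, Ω₂₁, Ω₂₂, h₁, h₂, h₃, h₄⟩ := exchange_amp_amp hΘ hk h hkl
      obtain ⟨x₁, x₂, hx'⟩ := hx (h.wellFormed_left hΘ) h₁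
      obtain ⟨y₁, y₂, hy'⟩ := hy (h.wellFormed_right hΘ) h₂
      exact ⟨.withRule l h₃ x₁ y₁, .withRule l h₄ x₂ y₂,
        (hx'.withRule l h hy').trans (.with_with ..)⟩

/-! ### Nets that split -/

/-- The links of `s` inside `R`. -/
def restr (s : Linking ι α) (R : Set (Addr ι)) : Linking ι α := {l ∈ s | Inside R l}

/-- Every link lies in one of the two regions, and the parts of two linkings in the two regions
can be recombined. -/
def NetSplits (θ : Set (Linking ι α)) (R₁ R₂ : Set (Addr ι)) : Prop :=
  (∀ s ∈ θ, ∀ l ∈ s, Inside R₁ l ∨ Inside R₂ l) ∧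
    ∀ s ∈ θ, ∀ t ∈ θ, restr s R₁ ∪ restr t R₂ ∈ θ

theorem NetSplits.symm {θ : Set (Linking ι α)} {R₁ R₂ : Set (Addr ι)} (h : NetSplits θ R₁ R₂) :
    NetSplits θ R₂ R₁ :=
  ⟨fun s hs l hl => (h.1 s hs l hl).symm, fun s hs t ht => Set.union_comm _ _ ▸ h.2 t ht s hs⟩

theorem restr_union (s t : Linking ι α) (R : Set (Addr ι)) :
    restr (s ∪ t) R = restr s R ∪ restr t R := by
  ext l
  exact or_and_right

theorem restr_eq_self {s : Linking ι α} {R : Set (Addr ι)} (h : ∀ l ∈ s, Inside R l) :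
    restr s R = s := Set.sep_eq_self_iff_mem_true.2 h

theorem restr_eq_empty {s : Linking ι α} {R R' : Set (Addr ι)} (h : ∀ l ∈ s, Inside R l)
    (hR : Disjoint R R') : restr s R' = ∅ :=
  Set.eq_empty_of_forall_notMem fun l hl => (h l hl.1).not_disjoint hl.2 hR

theorem restr_join_left {s t : Linking ι α} {R₁ R₂ : Set (Addr ι)} (hs : ∀ l ∈ s, Inside R₁ l)
    (ht : ∀ l ∈ t, Inside R₂ l) (hR : Disjoint R₁ R₂) : restr (s ∪ t) R₁ = s := by
  rw [restr_union, restr_eq_self hs, restr_eq_empty ht hR.symm, Set.union_empty]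

theorem restr_join_right {s t : Linking ι α} {R₁ R₂ : Set (Addr ι)} (hs : ∀ l ∈ s, Inside R₁ l)
    (ht : ∀ l ∈ t, Inside R₂ l) (hR : Disjoint R₁ R₂) : restr (s ∪ t) R₂ = t := by
  rw [Set.union_comm, restr_join_left ht hs hR.symm]

theorem joinNet_splits {θ₁ θ₂ : Set (Linking ι α)} {R₁ R₂ : Set (Addr ι)} (h₁ : NetOn θ₁ R₁)
    (h₂ : NetOn θ₂ R₂) (hR : Disjoint R₁ R₂) : NetSplits (joinNet θ₁ θ₂) R₁ R₂ := by
  constructor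
  · rintro _ ⟨s, hs, t, ht, rfl⟩ l (hl | hl)
    · exact .inl (h₁ s hs l hl)
    · exact .inr (h₂ t ht l hl)
  · rintro _ ⟨s, hs, t, ht, rfl⟩ _ ⟨s', hs', t', ht', rfl⟩
    rw [restr_join_left (h₁ s hs) (h₂ t ht) hR, restr_join_right (h₁ s' hs') (h₂ t' ht') hR]
    exact ⟨s, hs, t', ht', rfl⟩

theorem joinNet_left_subset {θ₁ θ₂ θ₁' θ₂' : Set (Linking ι α)} {R₁ R₂ : Set (Addr ι)}
    (h₁ : NetOn θ₁ R₁) (h₂ : NetOn θ₂ R₂) (h₁' : NetOn θ₁' R₁) (h₂' : NetOn θ₂' R₂)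
    (hR : Disjoint R₁ R₂) (hn : θ₂.Nonempty) (h : joinNet θ₁ θ₂ ⊆ joinNet θ₁' θ₂') :
    θ₁ ⊆ θ₁' := by
  intro s hs
  obtain ⟨t, ht⟩ := hn
  obtain ⟨s', hs', t', ht', he⟩ := h ⟨s, hs, t, ht, rfl⟩
  rwa [← restr_join_left (h₁ s hs) (h₂ t ht) hR, he,
    restr_join_left (h₁' s' hs') (h₂' t' ht') hR]

theorem joinNet_left_inj {θ₁ θ₂ θ₁' θ₂' : Set (Linking ι α)} {R₁ R₂ : Set (Addr ι)}
    (h₁ : NetOn θ₁ R₁) (h₂ : NetOn θ₂ R₂) (h₁' : NetOn θ₁' R₁) (h₂' : NetOn θ₂' R₂)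
    (hR : Disjoint R₁ R₂) (hn : θ₂.Nonempty) (hn' : θ₂'.Nonempty)
    (h : joinNet θ₁ θ₂ = joinNet θ₁' θ₂') : θ₁ = θ₁' :=
  (joinNet_left_subset h₁ h₂ h₁' h₂' hR hn h.subset).antisymm
    (joinNet_left_subset h₁' h₂' h₁ h₂ hR hn' h.superset)

theorem NetSplits.of_joinNet {θ₁ θ₂ : Set (Linking ι α)} {R₁ R₂ D₁ D₂ : Set (Addr ι)}
    (h : NetSplits (joinNet θ₁ θ₂) R₁ R₂) (h₁ : NetOn θ₁ D₁) (h₂ : NetOn θ₂ D₂)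
    (hD : Disjoint D₁ D₂) (hn : θ₂.Nonempty) : NetSplits θ₁ R₁ R₂ := by
  obtain ⟨t, ht⟩ := hn
  refine ⟨fun s hs l hl => h.1 _ ⟨s, hs, t, ht, rfl⟩ l (.inl hl), fun s hs s' hs' => ?_⟩
  obtain ⟨a, ha, b, hb, he⟩ := h.2 _ ⟨s, hs, t, ht, rfl⟩ _ ⟨s', hs', t, ht, rfl⟩
  have : restr (restr (s ∪ t) R₁ ∪ restr (s' ∪ t) R₂) D₁ = restr s R₁ ∪ restr s' R₂ := by
    rw [restr_union s, restr_union s', Set.union_union_union_comm]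
    refine restr_join_left (R₂ := D₂) ?_ ?_ hD
    · rintro l (hl | hl)
      · exact h₁ s hs l hl.1
      · exact h₁ s' hs' l hl.1
    · rintro l (hl | hl)
      · exact h₂ t ht l hl.1
      · exact h₂ t ht l hl.1
  rwa [← this, he, restr_join_left (h₁ a ha) (h₂ b hb) hD]

theorem NetHits.notMem {θ : Set (Linking ι α)} {T D : Set (Addr ι)} (h : NetHits θ T)
    (hD : Disjoint D T) {s : Linking ι α} (hs : ∀ l ∈ s, Inside D l) : s ∉ θ := by
  intro hsθ
  obtain ⟨l, hl, e, he, heT⟩ := h s hsθ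
  exact Set.disjoint_left.1 hD (hs l hl e he) heT

theorem NetSplits.of_union {θ θ' : Set (Linking ι α)} {R₁ R₂ D T : Set (Addr ι)}
    (h : NetSplits (θ ∪ θ') R₁ R₂) (h₁ : NetOn θ D) (h₂ : NetHits θ' T) (hD : Disjoint D T) :
    NetSplits θ R₁ R₂ := by
  refine ⟨fun s hs => h.1 s (.inl hs), fun s hs t ht => ?_⟩
  refine (h.2 s (.inl hs) t (.inl ht)).resolve_right (h₂.notMem hD ?_)
  rintro l (hl | hl)
  · exact h₁ s hs l hl.1
  · exact h₁ t ht l hl.1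

theorem union_left_subset {θ θ' φ φ' : Set (Linking ι α)} {D T : Set (Addr ι)}
    (h : θ ∪ θ' = φ ∪ φ') (h₁ : NetOn θ D) (h₂ : NetHits φ' T) (hD : Disjoint D T) : θ ⊆ φ :=
  fun s hs => (h.subset (.inl hs)).resolve_right (h₂.notMem hD (h₁ s hs))

theorem joinNet_union_right_subset {a b a' b' : Set (Linking ι α)} {R₁ R₂ D T : Set (Addr ι)}
    (h : NetSplits (joinNet a b ∪ joinNet a' b') R₁ R₂) (hR : Disjoint R₁ R₂)
    (ha : NetOn a R₁) (hb : NetOn b R₂) (ha' : NetOn a' R₁) (hb' : NetOn b' R₂)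
    (hn : a.Nonempty) (hn' : (joinNet a' b').Nonempty) (hD : NetOn (joinNet a b) D)
    (hT : NetHits a' T) (hDT : Disjoint D T) : b ⊆ b' := by
  intro t ht
  obtain ⟨s, hs⟩ := hn
  obtain ⟨_, s', hs', t', ht', rfl⟩ := hn'
  have := h.2 _ (.inr ⟨s', hs', t', ht', rfl⟩) _ (.inl ⟨s, hs, t, ht, rfl⟩)
  rw [restr_join_left (ha' s' hs') (hb' t' ht') hR, restr_join_right (ha s hs) (hb t ht) hR]
    at this
  rcases this with h' | ⟨p, hp, q, hq, he⟩
  · exact absurd hs' (hT.notMem hDT fun l hl => hD _ h' l (.inl hl))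
  · rwa [← restr_join_right (ha' s' hs') (hb t ht) hR, he,
      restr_join_right (ha' p hp) (hb' q hq) hR]

/-! ### Decompositions with possibly empty parts -/

/-- A proof of `Θ`, or nothing if `Θ` is empty. -/
inductive EProof (m : Bool) (Θ : OccSet ι α) : Type (max u v)
  | nil (h : Θ = ∅)
  | of (x : Proof m Θ)

/-- The third proof is convertible to the one obtained from the first two by a rule of kind `k`,
where a mix with nothing leaves the other proof unchanged. -/
inductive Decomp (k : JKind ι α) :
    {Θ₁ Θ₂ Θ : OccSet ι α} → EProof m Θ₁ → EProof m Θ₂ → EProof m Θ → Prop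
  | join {Θ₁ Θ₂ Θ : OccSet ι α} (hk : k.Ok m) (h : k.Rule Θ₁ Θ₂ Θ) {x : Proof m Θ₁}
      {y : Proof m Θ₂} {z : Proof m Θ} (hz : Convertible z (.join k hk h x y)) :
      Decomp k (.of x) (.of y) (.of z)
  | nil_left {Θ₁ Θ : OccSet ι α} (h₁ : Θ₁ = ∅) {y z : Proof m Θ} (hz : Convertible z y) :
      Decomp k (.nil h₁) (.of y) (.of z)
  | nil_right {Θ₂ Θ : OccSet ι α} (h₂ : Θ₂ = ∅) {x z : Proof m Θ} (hz : Convertible z x) :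
      Decomp k (.of x) (.nil h₂) (.of z)
  | nil_nil {Θ₁ Θ₂ Θ : OccSet ι α} (h₁ : Θ₁ = ∅) (h₂ : Θ₂ = ∅) (h : Θ = ∅) :
      Decomp k (.nil h₁) (.nil h₂) (.nil h)

namespace Decomp

variable {Θ₁ Θ₂ Θ₃ Φ Ψ Θ : OccSet ι α}

theorem flip {k : JKind ι α} {e₁ : EProof m Θ₁} {e₂ : EProof m Θ₂} {e : EProof m Θ}
    (h : Decomp k e₁ e₂ e) : Decomp k.flip e₂ e₁ e := by
  cases h with
  | join hk h hz => exact .join hk.flip h.flip (hz.trans (.join_flip ..))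
  | nil_left h₁ hz => exact .nil_right h₁ hz
  | nil_right h₂ hz => exact .nil_left h₂ hz
  | nil_nil h₁ h₂ h => exact .nil_nil h₂ h₁ h

theorem assoc {k l : JKind ι α} (h : k.Rule Θ₁ Φ Θ) (h₁ : l.Rule Θ₂ Θ₃ Φ) (h' : l.Rule Ψ Θ₃ Θ)
    (h₁' : k.Rule Θ₁ Θ₂ Ψ) {e₁ : EProof m Θ₁} {e₂ : EProof m Θ₂} {e₃ : EProof m Θ₃}
    {f : EProof m Φ} {e : EProof m Θ} (d : Decomp k e₁ f e) (d₁ : Decomp l e₂ e₃ f) :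
    ∃ g : EProof m Ψ, Decomp k e₁ e₂ g ∧ Decomp l g e₃ e := by
  cases d with
  | join hk _ hz =>
    cases d₁ with
    | join hl _ hz₁ =>
      exact ⟨_, .join hk h₁' (.refl _),
        .join hl h' (hz.trans (((Convertible.refl _).join k hk h hz₁).trans (.join_join ..)))⟩
    | nil_left e hz₁ =>
      subst e
      obtain ⟨rfl, rfl⟩ := h₁'.eq_of_right_empty
      obtain ⟨rfl, -⟩ := h₁.eq_of_left_empty
      exact ⟨_, .nil_right rfl (.refl _), .join hk h'
        (hz.trans ((Convertible.refl _).join _ hk h hz₁))⟩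
    | nil_right e hz₁ =>
      subst e
      obtain ⟨rfl, rfl⟩ := h'.eq_of_right_empty
      exact ⟨_, .join hk h (hz.trans ((Convertible.refl _).join _ hk h hz₁)),
        .nil_right rfl (.refl _)⟩
  | nil_left e hz =>
    subst e
    obtain ⟨rfl, rfl⟩ := h₁'.eq_of_left_empty
    cases d₁ with
    | join hl _ hz₁ => exact ⟨_, .nil_left rfl (.refl _), .join hl h' (hz.trans hz₁)⟩
    | nil_left e hz₁ => exact ⟨_, .nil_nil rfl e e, .nil_left e (hz.trans hz₁)⟩
    | nil_right e hz₁ => exact ⟨_, .nil_left rfl (.refl _), .nil_right e (hz.trans hz₁)⟩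
  | nil_right e hz =>
    cases d₁ with
    | nil_nil e₂ e₃ _ =>
      subst e₂
      obtain ⟨rfl, rfl⟩ := h₁'.eq_of_right_empty
      exact ⟨_, .nil_right rfl (.refl _), .nil_right e₃ hz⟩
  | nil_nil e₁ e e' =>
    cases d₁ with
    | nil_nil e₂ e₃ _ =>
      subst e₂
      obtain ⟨rfl, rfl⟩ := h₁'.eq_of_right_empty
      exact ⟨.nil e₁, .nil_nil _ _ _, .nil_nil _ _ _⟩

end Decomp

/-- The proof converts to one ending with the given rule. -/
def Reaches {Θ₁ Θ₂ Θ : OccSet ι α} (k : JKind ι α) (h : k.Rule Θ₁ Θ₂ Θ) (π : Proof m Θ) : Prop :=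
  ∃ hk x y, Convertible π (.join k hk h x y)

namespace Reaches

variable {Θ₁ Θ₂ Θ : OccSet ι α} {k : JKind ι α}

theorem of_convertible {h : k.Rule Θ₁ Θ₂ Θ} {π π' : Proof m Θ} (hr : Reaches k h π')
    (hc : Convertible π π') : Reaches k h π := by
  obtain ⟨hk, x, y, hz⟩ := hr
  exact ⟨hk, x, y, hc.trans hz⟩

theorem flip {h : k.Rule Θ₁ Θ₂ Θ} {π : Proof m Θ} (hr : Reaches k h π) :
    Reaches k.flip h.flip π := by
  obtain ⟨hk, x, y, hz⟩ := hr
  exact ⟨hk.flip, y, x, hz.trans (.join_flip ..)⟩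

theorem of_flip {h : k.Rule Θ₁ Θ₂ Θ} {π : Proof m Θ} (hr : Reaches k.flip h.flip π) :
    Reaches k h π := by
  have := hr.flip
  cases k <;> exact this

theorem of_decomp (h : k.Rule Θ₁ Θ₂ Θ) (h₁ : Θ₁.Nonempty) (h₂ : Θ₂.Nonempty)
    {e₁ : EProof m Θ₁} {e₂ : EProof m Θ₂} {π : Proof m Θ} (d : Decomp k e₁ e₂ (.of π)) :
    Reaches k h π := by
  cases d with
  | join hk _ hz => exact ⟨hk, _, _, hz⟩
  | nil_left e => exact absurd e h₁.ne_empty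
  | nil_right e => exact absurd e h₂.ne_empty

theorem decomp (h : k.Rule Θ₁ Θ₂ Θ) {π : Proof m Θ}
    (hr : Θ₁.Nonempty → Θ₂.Nonempty → Reaches k h π) :
    ∃ (e₁ : EProof m Θ₁) (e₂ : EProof m Θ₂), Decomp k e₁ e₂ (.of π) := by
  rcases Θ₁.eq_empty_or_nonempty with rfl | h₁
  · obtain ⟨-, rfl⟩ := h.eq_of_left_empty
    exact ⟨_, _, .nil_left rfl (.refl _)⟩
  rcases Θ₂.eq_empty_or_nonempty with rfl | h₂
  · obtain ⟨-, rfl⟩ := h.eq_of_right_empty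
    exact ⟨_, _, .nil_right rfl (.refl _)⟩
  obtain ⟨hk, x, y, hz⟩ := hr h₁ h₂
  exact ⟨_, _, .join hk h hz⟩

end Reaches

/-! ### Splitting a proof -/

/-- Every rule that divides the sequent between the two regions can be moved to the root. -/
def Splittable {Θ : OccSet ι α} (π : Proof m Θ) (R₁ R₂ : Set (Addr ι)) : Prop :=
  ∀ ⦃k : JKind ι α⦄ ⦃Θ₁ Θ₂ : OccSet ι α⦄ (h : k.Rule Θ₁ Θ₂ Θ), Θ₁.Nonempty → Θ₂.Nonempty →
    region Θ₁ ⊆ R₁ → region Θ₂ ⊆ R₂ → Reaches k h π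

theorem Splittable.symm {Θ : OccSet ι α} {π : Proof m Θ} {R₁ R₂ : Set (Addr ι)}
    (hs : Splittable π R₁ R₂) : Splittable π R₂ R₁ :=
  fun _ _ _ h h₁ h₂ hR₁ hR₂ => .of_flip (hs h.flip h₂ h₁ hR₂ hR₁)

theorem UKind.Rule.nonempty {l : UKind ι α} {Φ Θ : OccSet ι α} (h : l.Rule Φ Θ) : Φ.Nonempty :=
  h.hyp_eq ▸ l.args_nonempty.inr

theorem splittable_ax {a b : Addr ι} {P : α} {Θ : OccSet ι α} (h : AxRule a b P Θ)
    {R₁ R₂ : Set (Addr ι)} (hR : Disjoint R₁ R₂)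
    (hs : NetSplits (Proof.ax (m := m) h).net R₁ R₂) :
    Splittable (Proof.ax (m := m) h) R₁ R₂ := by
  intro k Θ₁ Θ₂ hk h₁ h₂ hR₁ hR₂
  exfalso
  have hsub := hk.prin_subset
  rw [← h.2] at hsub
  cases k with
  | tensor a A B => simpa using hsub rfl
  | tensorFlip a A B => simpa using hsub rfl
  | mix =>
    have key : ∀ {Δ : OccSet ι α} {R R' : Set (Addr ι)}, Disjoint R R' → Δ.Nonempty → Δ ⊆ Θ →
        region Δ ⊆ R' → ¬ Inside R s(((a, .var P) : Occ ι α), (b, .nvar P)) := by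
      rintro Δ R R' hd ⟨o, ho⟩ hΔ hR' hi
      refine Set.disjoint_left.1 hd ?_ (hR' ⟨o, ho, .refl _⟩)
      have := hΔ ho
      rw [← h.2] at this
      rcases this with rfl | rfl
      · exact hi _ (Sym2.mem_mk_left ..)
      · exact hi _ (Sym2.mem_mk_right ..)
    rcases hs.1 _ rfl _ rfl with hi | hi
    · exact key hR h₂ (hk.2 ▸ Set.subset_union_right) hR₂ hi
    · exact key hR.symm h₁ (hk.2 ▸ Set.subset_union_left) hR₁ hi

theorem splittable_un {Φ Θ : OccSet ι α} (hΘ : WellFormed Θ) {l : UKind ι α} (hl : l.Rule Φ Θ)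
    {x : Proof m Φ} {R₁ R₂ : Set (Addr ι)} (hx : Splittable x R₁ R₂) :
    Splittable (Proof.un l hl x) R₁ R₂ := by
  have key : ∀ {R₁ R₂ : Set (Addr ι)}, Splittable x R₁ R₂ → ∀ {k : JKind ι α}
      {Θ₁ Θ₂ : OccSet ι α} (hk : k.Rule Θ₁ Θ₂ Θ), Θ₂.Nonempty → region Θ₁ ⊆ R₁ →
      region Θ₂ ⊆ R₂ → l.prin ∈ Θ₁ → Reaches k hk (Proof.un l hl x) := by
    intro R₁ R₂ hx k Θ₁ Θ₂ hk h₂ hR₁ hR₂ hp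
    obtain ⟨Φ₁, hl', hk'⟩ := exchange_join_un hΘ hk hl hp
    obtain ⟨hok, y, z, hc⟩ := hx hk' hl'.nonempty h₂ (hl'.region_subset.trans hR₁) hR₂
    exact ⟨hok, .un l hl' y, z, (hc.un l hl).trans (Convertible.join_un ..).symm⟩
  intro k Θ₁ Θ₂ hk h₁ h₂ hR₁ hR₂
  rcases hk.prin_mem_or_un hl with hp | hp
  · exact key hx hk h₂ hR₁ hR₂ hp
  · exact .of_flip (key hx.symm hk.flip h₁ hR₂ hR₁ hp)

/-- On the smaller sequents, proofs with the same net are convertible. -/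
def NetsDetermine (ι : Type u) (α : Type v) (m : Bool) (n : ℕ) : Prop :=
  ∀ ⦃Θ : OccSet ι α⦄, WellFormed Θ → weight Θ < n → ∀ x y : Proof m Θ, x.net = y.net →
    Convertible x y

theorem splittable_with {n : ℕ} (ih : NetsDetermine ι α m n) {Φ Ψ Θ : OccSet ι α}
    (hΘ : WellFormed Θ) (hn : weight Θ ≤ n) {l : AKind ι α} (hl : l.Rule Φ Ψ Θ) {x : Proof m Φ}
    {y : Proof m Ψ} {R₁ R₂ : Set (Addr ι)} (hR : Disjoint R₁ R₂)
    (hs : NetSplits (Proof.withRule l hl x y).net R₁ R₂) (hx : Splittable x R₁ R₂)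
    (hy : Splittable y R₁ R₂) : Splittable (Proof.withRule l hl x y) R₁ R₂ := by
  have key : ∀ {R₁ R₂ : Set (Addr ι)}, Disjoint R₁ R₂ → NetSplits (x.net ∪ y.net) R₁ R₂ →
      Splittable x R₁ R₂ → Splittable y R₁ R₂ → ∀ {k : JKind ι α}
      {Θ₁ Θ₂ : OccSet ι α} (hk : k.Rule Θ₁ Θ₂ Θ), Θ₂.Nonempty → region Θ₁ ⊆ R₁ →
      region Θ₂ ⊆ R₂ → l.prin ∈ Θ₁ → Reaches k hk (Proof.withRule l hl x y) := by
    intro R₁ R₂ hR hs hx hy k Θ₁ Θ₂ hk h₂ hR₁ hR₂ hp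
    obtain ⟨Φ₁, Ψ₁, hl', hkΦ, hkΨ⟩ := exchange_join_amp hΘ hk hl hp
    have hΦ₁ : l.left ∈ Φ₁ := hl'.left_eq ▸ .inr rfl
    have hΨ₁ : l.right ∈ Ψ₁ := hl'.right_eq ▸ .inr rfl
    obtain ⟨hok, x₁, x₂, hcx⟩ := hx hkΦ ⟨_, hΦ₁⟩ h₂ (hl'.region_left.trans hR₁) hR₂
    obtain ⟨_, y₁, y₂, hcy⟩ := hy hkΨ ⟨_, hΨ₁⟩ h₂ (hl'.region_right.trans hR₁) hR₂
    have ex := hcx.net_eq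
    have ey := hcy.net_eq
    rw [Proof.net_join] at ex ey
    have on₁ : ∀ {Δ : OccSet ι α} {R : Set (Addr ι)} (z : Proof m Δ), region Δ ⊆ R →
        NetOn z.net R := fun z hR s hs l hl => (z.netOn s hs l hl).mono hR
    have hx₁ := on₁ x₁ (hl'.region_left.trans hR₁)
    have hy₁ := on₁ y₁ (hl'.region_right.trans hR₁)
    have hx₂ := on₁ x₂ hR₂
    have hy₂ := on₁ y₂ hR₂
    have hne : x₂.net = y₂.net := by
      refine Set.Subset.antisymm ?_ ?_
      · exact joinNet_union_right_subset (ex ▸ ey ▸ hs) hR hx₁ hx₂ hy₁ hy₂ x₁.net_nonempty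
          (ey ▸ y.net_nonempty) (ex ▸ x.netOn) (y₁.netHits hΨ₁) (hl.disjoint_left hΘ)
      · exact joinNet_union_right_subset (ex ▸ ey ▸ Set.union_comm x.net y.net ▸ hs) hR hy₁ hy₂
          hx₁ hx₂ y₁.net_nonempty (ex ▸ x.net_nonempty) (ey ▸ y.netOn) (x₁.netHits hΦ₁)
          (hl.disjoint_right hΘ)
    have hw : weight Θ₂ < n := by
      have := hk.weight_le hΘ
      have := weight_pos (hk.wellFormed_left hΘ).1 ⟨_, hp⟩
      omega
    have hc := ih (hk.wellFormed_right hΘ) hw x₂ y₂ hne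
    refine ⟨hok, .withRule l hl' x₁ y₁, x₂, ?_⟩
    exact (hcx.withRule l hl (hcy.trans ((Convertible.refl y₁).join k hok hkΨ hc.symm))).trans
      (Convertible.join_with ..).symm
  intro k Θ₁ Θ₂ hk h₁ h₂ hR₁ hR₂
  rcases hk.prin_mem_or_with hl with hp | hp
  · exact key hR hs hx hy hk h₂ hR₁ hR₂ hp
  · exact .of_flip (key hR.symm hs.symm hx.symm hy.symm hk.flip h₁ hR₂ hR₁ hp)

theorem reaches_join {k l : JKind ι α} {Θ₁ Θ₂ Δ₁ Δ₂ Θ : OccSet ι α} (hΘ : WellFormed Θ)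
    (hl : l.Ok m) (h : l.Rule Δ₁ Δ₂ Θ) {x : Proof m Δ₁} {y : Proof m Δ₂} {R₁ R₂ : Set (Addr ι)}
    (hx : Splittable x R₁ R₂) (hy : Splittable y R₁ R₂) (hk : k.Rule Θ₁ Θ₂ Θ)
    (h₁ : Θ₁.Nonempty) (h₂ : Θ₂.Nonempty) (hR₁ : region Θ₁ ⊆ R₁) (hR₂ : region Θ₂ ⊆ R₂)
    (hkΔ : k.prin ⊆ Δ₁) (hlΘ : l.prin ⊆ Θ₁) (hkl : Disjoint k.prin l.prin) :
    Reaches k hk (.join l hl h x y) := by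
  obtain ⟨X₁₁, X₂₁, X₁₂, X₂₂, Ψ, r₁, r₂, r₃, r₄, r₅, r₆, r₇⟩ :=
    exchange_join_join hΘ hk h hkΔ hlΘ hkl
  obtain ⟨x₁₁, x₂₁, dx⟩ := Reaches.decomp r₁ fun n₁ n₂ =>
    hx r₁ n₁ n₂ (r₃.region_left.trans hR₁) (r₄.region_left.trans hR₂)
  obtain ⟨x₁₂, x₂₂, dy⟩ := Reaches.decomp r₂ fun n₁ n₂ =>
    hy r₂ n₁ n₂ (r₃.region_right.trans hR₁) (r₄.region_right.trans hR₂)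
  have d : Decomp l (.of x) (.of y) (.of (.join l hl h x y)) := .join hl h (.refl _)
  obtain ⟨g, d₁, d₂⟩ := Decomp.assoc h r₂ r₇ r₅ d dy
  obtain ⟨t₁, d₃, d₄⟩ := Decomp.assoc r₅.flip r₁ r₆ r₃.flip d₁.flip dx
  obtain ⟨t₂, d₅, d₆⟩ := Decomp.assoc r₇.flip r₆.flip hk.flip r₄.flip d₂.flip d₄.flip
  exact .of_flip (.of_decomp hk.flip h₂ h₁ d₆)

theorem reaches_join_self {k : JKind ι α} {Θ₁ Θ₂ Δ₁ Δ₂ Θ : OccSet ι α} (hΘ : WellFormed Θ)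
    (hok : k.Ok m) (h : k.Rule Δ₁ Δ₂ Θ) {x : Proof m Δ₁} {y : Proof m Δ₂} {R₁ R₂ : Set (Addr ι)}
    (hx : Splittable x R₁ R₂) (hy : Splittable y R₁ R₂) (hk : k.Rule Θ₁ Θ₂ Θ)
    (h₁ : Θ₁.Nonempty) (h₂ : Θ₂.Nonempty) (hR₁ : region Θ₁ ⊆ R₁) (hR₂ : region Θ₂ ⊆ R₂) :
    Reaches k hk (.join k hok h x y) := by
  obtain ⟨X₁₁, X₂₁, X₁₂, X₂₂, Ψ, Ψ₁, Ψ₂, r₁, r₂, r₃, r₄, r₅, r₆, r₇, r₈, r₉, r₁₀, r₁₁⟩ :=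
    exchange_join_self hΘ hk h
  obtain ⟨x₁₁, x₂₁, dx⟩ := Reaches.decomp r₁ fun n₁ n₂ =>
    hx r₁ n₁ n₂ (r₃.region_left.trans hR₁) (r₄.region_left.trans hR₂)
  obtain ⟨x₁₂, x₂₂, dy⟩ := Reaches.decomp r₂ fun n₁ n₂ =>
    hy r₂ n₁ n₂ (r₃.region_right.trans hR₁) (r₄.region_right.trans hR₂)
  have d : Decomp k (.of x) (.of y) (.of (.join k hok h x y)) := .join hok h (.refl _)
  obtain ⟨g₁, d₁, d₂⟩ := Decomp.assoc h r₂.flip r₈ r₆ d dy.flip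
  obtain ⟨c, d₃, d₄⟩ := Decomp.assoc r₆.flip r₁ r₇ r₅.flip d₁.flip dx
  obtain ⟨g₂, d₅, d₆⟩ := Decomp.assoc r₈.flip r₇ r₁₁ r₁₀.flip d₂.flip d₄
  have d₃' : Decomp k x₁₁ x₂₂ c := k.flip_flip ▸ d₃.flip
  obtain ⟨t₁, d₇, d₈⟩ := Decomp.assoc r₁₀.flip r₅ r₉ r₃.flip d₅ d₃'
  obtain ⟨t₂, d₉, d₁₀⟩ := Decomp.assoc r₁₁.flip r₉.flip hk.flip r₄ d₆.flip d₈.flip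
  exact .of_flip (.of_decomp hk.flip h₂ h₁ d₁₀)

theorem JKind.eq_or_disjoint (k l : JKind ι α) :
    (l = k ∨ l = k.flip) ∨ Disjoint k.prin l.prin := by
  by_cases h : k.prin = l.prin
  · left
    cases k <;> cases l <;> simp_all [prin, flip]
  · right
    cases k <;> cases l <;> simp_all [prin]

theorem JKind.Rule.prin_subset_or {k l : JKind ι α} {Θ₁ Θ₂ Δ₁ Δ₂ Θ : OccSet ι α}
    (hk : k.Rule Θ₁ Θ₂ Θ) (hl : l.Rule Δ₁ Δ₂ Θ) (h : Disjoint k.prin l.prin) :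
    k.prin ⊆ Δ₁ ∨ k.prin ⊆ Δ₂ := by
  have hsub := hk.prin_subset
  cases k with
  | mix => exact .inl (Set.empty_subset _)
  | _ =>
    simp only [prin, Set.singleton_subset_iff, Set.disjoint_singleton_left] at h hsub ⊢
    exact hl.mem_or_mem hsub h

theorem splittable_join {l : JKind ι α} {Δ₁ Δ₂ Θ : OccSet ι α} (hΘ : WellFormed Θ)
    (hl : l.Ok m) (h : l.Rule Δ₁ Δ₂ Θ) {x : Proof m Δ₁} {y : Proof m Δ₂} {R₁ R₂ : Set (Addr ι)}
    (hx : Splittable x R₁ R₂) (hy : Splittable y R₁ R₂) :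
    Splittable (Proof.join l hl h x y) R₁ R₂ := by
  intro k Θ₁ Θ₂ hk h₁ h₂ hR₁ hR₂
  rcases k.eq_or_disjoint l with (rfl | rfl) | hkl
  · exact reaches_join_self hΘ hl h hx hy hk h₁ h₂ hR₁ hR₂
  · exact .of_flip (reaches_join_self hΘ hl h hx.symm hy.symm hk.flip h₂ h₁ hR₂ hR₁)
  · have hkl₁ : Disjoint k.prin l.flip.prin := l.prin_flip.symm ▸ hkl
    rcases hk.prin_subset_or h hkl with hkΔ | hkΔ <;>
      rcases h.prin_subset_or hk hkl.symm with hlΘ | hlΘ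
    · exact reaches_join hΘ hl h hx hy hk h₁ h₂ hR₁ hR₂ hkΔ hlΘ hkl
    · rw [← k.prin_flip] at hkΔ hkl
      exact .of_flip (reaches_join hΘ hl h hx.symm hy.symm hk.flip h₂ h₁ hR₂ hR₁ hkΔ hlΘ hkl)
    · rw [← l.prin_flip] at hlΘ
      exact .of_convertible (reaches_join hΘ hl.flip h.flip hy hx hk h₁ h₂ hR₁ hR₂ hkΔ hlΘ hkl₁)
        (.join_flip ..)
    · rw [← k.prin_flip] at hkΔ hkl₁
      rw [← l.prin_flip] at hlΘ
      exact .of_convertible (.of_flip (reaches_join hΘ hl.flip h.flip hy.symm hx.symm hk.flip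
        h₂ h₁ hR₂ hR₁ hkΔ hlΘ hkl₁)) (.join_flip ..)

theorem splittable_of_netSplits {n : ℕ} (ih : NetsDetermine ι α m n) {Θ : OccSet ι α}
    (π : Proof m Θ) (hΘ : WellFormed Θ) (hn : weight Θ ≤ n) {R₁ R₂ : Set (Addr ι)}
    (hR : Disjoint R₁ R₂) (hs : NetSplits π.net R₁ R₂) : Splittable π R₁ R₂ := by
  induction π using Proof.kindInduction with
  | ax a b P h => exact splittable_ax h hR hs
  | join l hl h x y hx hy =>
    have hw := h.weight_le hΘ
    rw [Proof.net_join] at hs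
    have hd := h.disjoint_region hΘ
    refine splittable_join hΘ hl h
      (hx (h.wellFormed_left hΘ) (by omega) (hs.of_joinNet x.netOn y.netOn hd y.net_nonempty))
      (hy (h.wellFormed_right hΘ) (by omega) ?_)
    rw [joinNet_comm] at hs
    exact hs.of_joinNet y.netOn x.netOn hd.symm x.net_nonempty
  | un l h x hx =>
    have hw := h.weight_lt hΘ
    rw [Proof.net_un] at hs
    exact splittable_un hΘ h (hx (h.wellFormed hΘ) (by omega) hs)
  | withRule l h x y hx hy =>
    have hw := h.weight_lt hΘ
    have hxl : l.left ∈ _ := h.left_eq.superset (.inr rfl)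
    have hyr : l.right ∈ _ := h.right_eq.superset (.inr rfl)
    refine splittable_with ih hΘ hn h hR hs
      (hx (h.wellFormed_left hΘ) (by omega) ?_) (hy (h.wellFormed_right hΘ) (by omega) ?_)
    · exact NetSplits.of_union hs x.netOn (y.netHits hyr) (h.disjoint_left hΘ)
    · rw [Proof.net_withRule, Set.union_comm] at hs
      exact NetSplits.of_union hs y.netOn (x.netHits hxl) (h.disjoint_right hΘ)

/-! ### Proofs with the same net -/

section Root

variable {n : ℕ} {Θ₁ Θ₂ Θ : OccSet ι α}

theorem convertible_join (ih : NetsDetermine ι α m n) (hΘ : WellFormed Θ) (hn : weight Θ ≤ n)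
    (π : Proof m Θ) (k : JKind ι α) (hk : k.Ok m) (h : k.Rule Θ₁ Θ₂ Θ) (x : Proof m Θ₁)
    (y : Proof m Θ₂) (e : π.net = (Proof.join k hk h x y).net) :
    Convertible π (.join k hk h x y) := by
  have hd := h.disjoint_region hΘ
  rw [Proof.net_join] at e
  obtain ⟨_, x', y', hc⟩ := splittable_of_netSplits ih π hΘ hn hd
    (e ▸ joinNet_splits x.netOn y.netOn hd) h x.nonempty y.nonempty subset_rfl subset_rfl
  have e' := hc.net_eq.symm.trans e
  rw [Proof.net_join] at e'
  have ex := joinNet_left_inj x'.netOn y'.netOn x.netOn y.netOn hd y'.net_nonempty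
    y.net_nonempty e'
  rw [joinNet_comm, joinNet_comm x.net] at e'
  have ey := joinNet_left_inj y'.netOn x'.netOn y.netOn x.netOn hd.symm x'.net_nonempty
    x.net_nonempty e'
  have hw := h.weight_le hΘ
  have hΘ₁ := h.wellFormed_left hΘ
  have hΘ₂ := h.wellFormed_right hΘ
  have := weight_pos hΘ₁.1 x.nonempty
  have := weight_pos hΘ₂.1 y.nonempty
  exact hc.trans ((ih hΘ₁ (by omega) x' x ex).join k hk h (ih hΘ₂ (by omega) y' y ey))

theorem Proof.un_netAvoids (hΘ : WellFormed Θ) (k : UKind ι α) (h : k.Rule Θ₁ Θ)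
    (x : Proof m Θ₁) : NetAvoids x.net k.dropped := by
  cases k with
  | par => exact fun _ _ _ _ _ _ => id
  | plus i a A B =>
    intro s hs l hl e he hb
    obtain ⟨o, ho, hw⟩ := x.netOn s hs l hl e he
    rw [h.hyp_eq] at ho
    rcases ho with ho | rfl
    · exact ho.2 (hΘ.2 o ho.1 _ h.prin_mem _ hw ((Addr.below_arg ..).trans hb))
    · have := Addr.arg_below_inj hw hb
      simp at this

theorem convertible_un (ih : NetsDetermine ι α m n) (hΘ : WellFormed Θ) (hn : weight Θ ≤ n)
    (π : Proof m Θ) (k : UKind ι α) (h : k.Rule Θ₁ Θ) (x : Proof m Θ₁)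
    (e : π.net = (Proof.un k h x).net) : Convertible π (.un k h x) := by
  rw [Proof.net_un] at e
  obtain ⟨x', hc⟩ := lower_un π hΘ h (e ▸ x.un_netAvoids hΘ k h)
  have e' := hc.net_eq.symm.trans e
  rw [Proof.net_un] at e'
  exact hc.trans ((ih (h.wellFormed hΘ) ((h.weight_lt hΘ).trans_le hn) x' x e').un k h)

theorem convertible_with (ih : NetsDetermine ι α m n) (hΘ : WellFormed Θ) (hn : weight Θ ≤ n)
    (π : Proof m Θ) (k : AKind ι α) (h : k.Rule Θ₁ Θ₂ Θ) (x : Proof m Θ₁) (y : Proof m Θ₂)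
    (e : π.net = (Proof.withRule k h x y).net) : Convertible π (.withRule k h x y) := by
  obtain ⟨x', y', hc⟩ := lower_with π hΘ h
  have e' : x'.net ∪ y'.net = x.net ∪ y.net := hc.net_eq.symm.trans e
  have hl : k.left ∈ Θ₁ := h.left_eq.superset (.inr rfl)
  have hr : k.right ∈ Θ₂ := h.right_eq.superset (.inr rfl)
  have dl := h.disjoint_left hΘ
  have dr := h.disjoint_right hΘ
  have ex : x'.net = x.net := (union_left_subset e' x'.netOn (y.netHits hr) dl).antisymm
    (union_left_subset e'.symm x.netOn (y'.netHits hr) dl)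
  rw [Set.union_comm, Set.union_comm x.net] at e'
  have ey : y'.net = y.net := (union_left_subset e' y'.netOn (x.netHits hl) dr).antisymm
    (union_left_subset e'.symm y.netOn (x'.netHits hl) dr)
  have hw := h.weight_lt hΘ
  exact hc.trans ((ih (h.wellFormed_left hΘ) (by omega) x' x ex).withRule k h
    (ih (h.wellFormed_right hΘ) (by omega) y' y ey))

theorem AxRule.unique {a a' b b' : Addr ι} {P P' : α} (h : AxRule a b P Θ)
    (h' : AxRule a' b' P' Θ) : a = a' ∧ b = b' ∧ P = P' := by
  have h₁ : ((a, .var P) : Occ ι α) ∈ Θ := h.2.subset (.inl rfl)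
  have h₂ : ((b, .nvar P) : Occ ι α) ∈ Θ := h.2.subset (.inr rfl)
  rw [← h'.2] at h₁ h₂
  simp at h₁ h₂
  exact ⟨h₁.1, h₂.1, h₁.2⟩

theorem netsDetermine_step (ih : NetsDetermine ι α m n) (hΘ : WellFormed Θ) (hn : weight Θ ≤ n)
    (π π' : Proof m Θ) (e : π.net = π'.net) : Convertible π π' := by
  induction π' using Proof.kindInduction with
  | join k hk h x y => exact convertible_join ih hΘ hn π k hk h x y e
  | un k h x => exact convertible_un ih hΘ hn π k h x e
  | withRule k h x y => exact convertible_with ih hΘ hn π k h x y e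
  | ax a' b' P' h' =>
    induction π using Proof.kindInduction with
    | join k hk h x y => exact (convertible_join ih hΘ hn _ k hk h x y e.symm).symm
    | un k h x => exact (convertible_un ih hΘ hn _ k h x e.symm).symm
    | withRule k h x y => exact (convertible_with ih hΘ hn _ k h x y e.symm).symm
    | ax a b P h =>
      obtain ⟨rfl, rfl, rfl⟩ := h.unique h'
      exact .refl _

end Root

theorem netsDetermine (n : ℕ) : NetsDetermine ι α m n := by
  induction n with
  | zero => exact fun _ _ h => absurd h (Nat.not_lt_zero _)
  | succ n ih => exact fun _ hΘ hn x y e => netsDetermine_step ih hΘ (Nat.le_of_lt_succ hn) x y e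

end MALL

theorem mainTheorem2 {ι α : Type*} [Finite ι] (m : Bool) (Γ : ι → MALL.Formula α)
    (π π' : MALL.Proof m (MALL.sequent Γ)) :
    π.net = π'.net ↔ MALL.Convertible π π' :=
  ⟨MALL.netsDetermine _ (MALL.wellFormed_sequent Γ) (Nat.lt_succ_self _) π π',
    MALL.Convertible.net_eq⟩
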